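/- Let $p$ be an odd prime, $q=p^m$ with $m\ge 1$, let $\mathbb F_q$ be the field with $q$ elements, and for $c\in\mathbb F_q$ and $n\ge 1$ let $N_n(c)$ be the number of $(x_1,\dots,x_n)\in\mathbb F_q^n$ with $x_1^4+\cdots+x_n^4=c$. The identities below are identities of formal power series in $x$. (i) Suppose $q\equiv 1\pmod 4$. Let $g$ be a generator of $\mathbb F_q^*$, and for $c\in\mathbb F_q^*$ let $\mathrm{ind}_g(c)$ be the least integer $k\ge 0$ with $g^k=c$. If $p\equiv 3\pmod 4$, put $s=(-p)^{m/2}$ and $t=0$. If $p\equiv 1\pmod 4$, there is exactly one pair of integers $(s,t)$ such that $$q=s^2+4t^2,\quad \gcd(p,s)=1,\quad s\equiv 1\pmod 4,\quad 2t\equiv s\,g^{3(q-1)/4}\pmod p,$$ the last congruence being an equality in $\mathbb F_q$; let $(s,t)$ be this pair. Then for every $c\in\mathbb F_q^*$ $$\sum_{n=1}^\infty N_n(c)x^n=\begin{cases}\dfrac{x}{1-qx}+\dfrac{6sx^3+(q-4s^2)x^4+B_1(c,x)}{1-6qx^2+8qsx^3+(q^2-4qs^2)x^4}, & q\equiv 1\pmod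 8,\\[2ex] \dfrac{x}{1-qx}+\dfrac{6sx^3+(9q-4s^2)x^4+B_2(c,x)}{1+2qx^2+8qsx^3+(9q^2-4qs^2)x^4}, & q\equiv 5\pmod 8,\end{cases}$$ where $$B_1(c,x)=\begin{cases}3x-(6s+3)x^2+(-q+4s^2)x^3, & \mathrm{ind}_g(c)\equiv 0\pmod 4,\\ -x+(2s+8t-3)x^2+(-q-8st)x^3, & \mathrm{ind}_g(c)\equiv 1\pmod 4,\\ -x+(2s-3)x^2+(-q+16t^2)x^3, & \mathrm{ind}_g(c)\equiv 2\pmod 4,\\ -x+(2s-8t-3)x^2+(-q+8st)x^3, & \mathrm{ind}_g(c)\equiv 3\pmod 4,\end{cases}$$ $$B_2(c,x)=\begin{cases}3x+(2s+1)x^2+(3q-4s^2)x^3, & \mathrm{ind}_g(c)\equiv 0\pmod 4,\\ -x+(2s-8t+1)x^2+(3q+8st)x^3, & \mathrm{ind}_g(c)\equiv 1\pmod 4,\\ -x+(-6s+1)x^2+(-5q-16t^2)x^3, & \mathrm{ind}_g(c)\equiv 2\pmod 4,\\ -x+(2s+8t+1)x^2+(3q-8st)x^3, & \mathrm{ind}_g(c)\equiv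 3\pmod 4.\end{cases}$$ (ii) If $q\equiv 3\pmod 4$, then for every $c\in\mathbb F_q$ $$\sum_{n=1}^\infty N_n(c)x^n=\begin{cases}\dfrac{x}{1-qx}+\dfrac{(1-q)x^2}{1+qx^2}, & c=0,\\[2ex] \dfrac{x}{1-qx}+\dfrac{x+x^2}{1+qx^2}, & c\ne 0\text{ a square},\\[2ex] \dfrac{x}{1-qx}+\dfrac{-x+x^2}{1+qx^2}, & c\text{ a non-square}.\end{cases}$$ -/

import Mathlib

/-- `quarticCount F n c` is the number `N_n(c)` of solutions `(x_1, …, x_n) ∈ F^n` of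
`x_1^4 + ⋯ + x_n^4 = c`. -/
noncomputable def quarticCount (F : Type*) [Field F] (n : ℕ) (c : F) : ℕ :=
  Nat.card {x : Fin n → F // ∑ i, x i ^ 4 = c}

/-- The generating function `∑_{n ≥ 1} N_n(c) x^n` (the constant term is `0`). -/
noncomputable def quarticGenFun (F : Type*) [Field F] (c : F) : PowerSeries ℚ :=
  PowerSeries.mk fun n => if n = 0 then 0 else (quarticCount F n c : ℚ)

/-- The index `ind_g(c)` of `c` to the base `g`: the least `k ≥ 0` with `g^k = c`. -/
noncomputable def indexBase {G : Type*} [Group G] (g c : G) : ℕ :=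
  sInf {k : ℕ | g ^ k = c}

/-- The integers `s, t` attached to the field `F` of `q = p^m` elements and the generator `g`
of its multiplicative group. The congruence
`2t ≡ s g^{3(q-1)/4} (mod p)` is an equality in `F`. -/
def QuarticParams {F : Type*} [Field F] (p m q : ℕ) (g : Fˣ) (s t : ℤ) : Prop :=
  (p % 4 = 1 →
    (q : ℤ) = s ^ 2 + 4 * t ^ 2 ∧ Int.gcd (p : ℤ) s = 1 ∧ s ≡ 1 [ZMOD 4] ∧
      (2 * (t : F)) = (s : F) * (g : F) ^ (3 * (q - 1) / 4)) ∧
  (p % 4 = 3 → s = (-(p : ℤ)) ^ (m / 2) ∧ t = 0)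

/-- The polynomial `B_1(c, x)`, as a function of `k = ind_g(c)`. -/
noncomputable def quarticB1 (q : ℕ) (s t : ℤ) (k : ℕ) : Polynomial ℚ :=
  let x : Polynomial ℚ := Polynomial.X
  if k % 4 = 0 then
    3 * x - (6 * s + 3) * x ^ 2 + (-q + 4 * s ^ 2) * x ^ 3
  else if k % 4 = 1 then
    -x + (2 * s + 8 * t - 3) * x ^ 2 + (-q - 8 * s * t) * x ^ 3
  else if k % 4 = 2 then
    -x + (2 * s - 3) * x ^ 2 + (-q + 16 * t ^ 2) * x ^ 3
  else
    -x + (2 * s - 8 * t - 3) * x ^ 2 + (-q + 8 * s * t) * x ^ 3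

/-- The polynomial `B_2(c, x)`, as a function of `k = ind_g(c)`. -/
noncomputable def quarticB2 (q : ℕ) (s t : ℤ) (k : ℕ) : Polynomial ℚ :=
  let x : Polynomial ℚ := Polynomial.X
  if k % 4 = 0 then
    3 * x + (2 * s + 1) * x ^ 2 + (3 * q - 4 * s ^ 2) * x ^ 3
  else if k % 4 = 1 then
    -x + (2 * s - 8 * t + 1) * x ^ 2 + (3 * q + 8 * s * t) * x ^ 3
  else if k % 4 = 2 then
    -x + (-6 * s + 1) * x ^ 2 + (-5 * q - 16 * t ^ 2) * x ^ 3
  else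
    -x + (2 * s + 8 * t + 1) * x ^ 2 + (3 * q - 8 * s * t) * x ^ 3

/-- The power series expansion at `0` of the rational function `num / den`; it is only used for
denominators with constant term `1`, where the inverse is the genuine inverse. -/
noncomputable def expandFrac (num den : Polynomial ℚ) : PowerSeries ℚ :=
  (num : PowerSeries ℚ) * (den : PowerSeries ℚ)⁻¹

/-! By orthogonality of a primitive additive character ψ, q·N_n(c) = ∑_a ψ(-ac) S(a)^n with S(a) =
∑_x ψ(a x⁴). The term a = 0 gives q^n, hence the summand x/(1-qx).

For q = 4f+1 take a quartic character χ with χ(g) = i. For a ≠ 0, S(a) depends only on χ(a): it is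
one of four periods S_j, combinations of the Gauss sums y, w, z of χ, χ², χ³. The sum of ψ(-ac) over
a fixed class of a is (S_k - 1)/4, where k is the index of the class shifted by that of -c. So the
remaining series is a sum of four geometric series, with denominator ∏(1 - S_j x). Everything
reduces to w² = q, yz = (-1)^f q, and y², z² = (-s ± 2ti)w, which come from the Jacobi sum J(χ,χ²)
(`gaussSum_relations`).

The integers s, t are, up to sign, the real part and half the imaginary part of that Jacobi sum. A
congruence modulo 2(i-1) in ℤ[i] fixes s modulo 4, reduction ℤ[i] → F gives 2t = s g^{3f}, and a
binomial coefficient prime to p gives gcd(p,s) = 1 when p ≡ 1 (mod 4) (`exists_quarticParams`).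
Uniqueness is the classical argument for two representations by s² + 4t².

For q ≡ 3 (mod 4) fourth powers are squares, and the quadratic Gauss sum, with square -q, suffices.
-/

/-! ### Power series and rational functions -/

/-- The power series `∑_{n ≥ 1} r^n X^n`. -/
noncomputable def geomSeries (r : ℂ) : PowerSeries ℂ :=
  PowerSeries.mk fun n => if n = 0 then 0 else r ^ n

theorem geomSeries_mul (r : ℂ) :
    geomSeries r * (1 - PowerSeries.C r * PowerSeries.X) = PowerSeries.C r * PowerSeries.X := by
  ext n
  rw [mul_sub, mul_one, mul_comm (PowerSeries.C r), ← mul_assoc]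
  rcases n with _ | _ | n
  · simp [geomSeries]
  · simp [geomSeries, PowerSeries.coeff_succ_mul_X, mul_comm PowerSeries.X]
  · simp [geomSeries, PowerSeries.coeff_succ_mul_X, mul_comm PowerSeries.X, pow_succ]

/-- Rational polynomials as complex power series. -/
noncomputable def polyToSeries : Polynomial ℚ →+* PowerSeries ℂ :=
  (PowerSeries.map (algebraMap ℚ ℂ)).comp Polynomial.coeToPowerSeries.ringHom

theorem polyToSeries_apply (P : Polynomial ℚ) :
    polyToSeries P = PowerSeries.map (algebraMap ℚ ℂ) (P : PowerSeries ℚ) := rfl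

@[simp]
theorem polyToSeries_X : polyToSeries Polynomial.X = PowerSeries.X := by
  simp [polyToSeries_apply]

theorem expandFrac_mul_den (num den : Polynomial ℚ) (h : den.coeff 0 = 1) :
    expandFrac num den * (den : PowerSeries ℚ) = num := by
  rw [expandFrac, mul_assoc, PowerSeries.inv_mul_cancel, mul_one]
  simp [h]

theorem powerSeries_natCast_ne_zero {n : ℕ} (hn : n ≠ 0) : (n : PowerSeries ℂ) ≠ 0 := by
  intro h0
  have := congrArg (PowerSeries.coeff 0) h0
  rw [← map_natCast (PowerSeries.C (R := ℂ))] at this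
  simp [hn] at this

/-- Gauss sums force the computation into ℂ⟦X⟧. After clearing denominators, injectivity of ℚ⟦X⟧ →
ℂ⟦X⟧ brings the identity back. -/
theorem eq_expandFrac_add_expandFrac {q : ℕ} (hq : q ≠ 0) (f : PowerSeries ℚ)
    (num den : Polynomial ℚ) (hden : den.coeff 0 = 1) (H : PowerSeries ℂ)
    (hf : (q : PowerSeries ℂ) * PowerSeries.map (algebraMap ℚ ℂ) f = geomSeries q + H)
    (hH : H * polyToSeries den = q * polyToSeries num) :
    f = expandFrac Polynomial.X (1 - (q : Polynomial ℚ) * Polynomial.X) + expandFrac num den := by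
  have hD : (1 - (q : Polynomial ℚ) * Polynomial.X).coeff 0 = 1 := by simp
  have h1 := expandFrac_mul_den Polynomial.X _ hD
  have h2 := expandFrac_mul_den num _ hden
  have ne : ∀ P : Polynomial ℚ, P.coeff 0 = 1 → (P : PowerSeries ℚ) ≠ 0 := by
    intro P hP h0
    have := congrArg (PowerSeries.coeff 0) h0
    simp [hP] at this
  apply mul_right_cancel₀ (mul_ne_zero (ne _ hD) (ne _ hden))
  have key : f * ((1 - (q : Polynomial ℚ) * Polynomial.X : Polynomial ℚ) * (den : PowerSeries ℚ)) =
      (Polynomial.X : Polynomial ℚ) * (den : PowerSeries ℚ) +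
        num * ((1 - (q : Polynomial ℚ) * Polynomial.X : Polynomial ℚ) : PowerSeries ℚ) := by
    apply PowerSeries.map_injective (algebraMap ℚ ℂ) (algebraMap ℚ ℂ).injective
    apply mul_left_cancel₀ (powerSeries_natCast_ne_zero hq)
    have h3 := geomSeries_mul (q : ℂ)
    simp only [map_mul, map_add, ← polyToSeries_apply]
    simp only [map_sub, map_one, map_mul, map_natCast, polyToSeries_X] at h3 ⊢
    linear_combination (1 - (q : PowerSeries ℂ) * PowerSeries.X) * polyToSeries den * hf +
      polyToSeries den * h3 + (1 - (q : PowerSeries ℂ) * PowerSeries.X) * hH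
  rw [key]
  linear_combination -(den : PowerSeries ℚ) * h1 -
    ((1 - (q : Polynomial ℚ) * Polynomial.X : Polynomial ℚ) : PowerSeries ℚ) * h2

/-! ### Counting solutions with additive characters -/

section Fintype
variable {F : Type*} [Field F] [Fintype F]

theorem card_mul_quarticCount {ψ : AddChar F ℂ} (hψ : ψ.IsPrimitive) (n : ℕ) (c : F) :
    (Fintype.card F : ℂ) * quarticCount F n c =
      ∑ a : F, ψ (a * -c) * (∑ x : F, ψ (a * x ^ 4)) ^ n := by
  classical
  have h : ∀ a : F, ψ (a * -c) * (∑ x : F, ψ (a * x ^ 4)) ^ n =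
      ∑ x : Fin n → F, ψ (a * (∑ i, x i ^ 4 - c)) := by
    intro a
    rw [← Fin.prod_const, Finset.prod_univ_sum, Fintype.piFinset_univ, Finset.mul_sum]
    refine Finset.sum_congr rfl fun x _ => ?_
    have hprod : ∏ i, ψ (a * x i ^ 4) = ψ (a * ∑ i, x i ^ 4) := by
      rw [Finset.mul_sum]
      exact (map_prod ψ.toMonoidHom (fun i => Multiplicative.ofAdd (a * x i ^ 4)) _).symm
    rw [hprod, ← AddChar.map_add_eq_mul]
    congr 1
    ring
  simp_rw [h]
  rw [Finset.sum_comm]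
  simp_rw [AddChar.sum_mulShift _ hψ, sub_eq_zero]
  rw [quarticCount, Nat.card_eq_fintype_card, Fintype.card_subtype, ← Nat.cast_sum,
    Finset.sum_ite]
  simp [mul_comm]

theorem card_mul_quarticCount_eq_add [DecidableEq F] {ψ : AddChar F ℂ} (hψ : ψ.IsPrimitive) (n : ℕ) (c : F) :
    (Fintype.card F : ℂ) * quarticCount F n c = (Fintype.card F : ℂ) ^ n +
      ∑ a ∈ Finset.univ.erase (0 : F), ψ (a * -c) * (∑ x : F, ψ (a * x ^ 4)) ^ n := by
  rw [card_mul_quarticCount hψ, ← Finset.add_sum_erase _ _ (Finset.mem_univ (0 : F))]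
  simp

theorem card_mul_map_quarticGenFun (c : F) (H : ℕ → ℂ)
    (h : ∀ n, n ≠ 0 → (Fintype.card F : ℂ) * quarticCount F n c = (Fintype.card F : ℂ) ^ n + H n) :
    ((Fintype.card F : ℕ) : PowerSeries ℂ) *
        PowerSeries.map (algebraMap ℚ ℂ) (quarticGenFun F c) =
      geomSeries (Fintype.card F : ℕ) + PowerSeries.mk fun n => if n = 0 then 0 else H n := by
  ext n
  rw [← map_natCast (PowerSeries.C (R := ℂ)), PowerSeries.coeff_C_mul]
  rcases eq_or_ne n 0 with rfl | hn
  · simp [quarticGenFun, geomSeries]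
  · simp [quarticGenFun, geomSeries, hn, h n hn]

end Fintype

/-! ### The quartic character and the sums of ψ(b x⁴) -/

theorem eq_of_pow_four_eq_one {u : ℂ} (h : u ^ 4 = 1) :
    u = 1 ∨ u = Complex.I ∨ u = -1 ∨ u = -Complex.I := by
  have : (u - 1) * ((u - Complex.I) * ((u + 1) * (u + Complex.I))) = 0 := by
    linear_combination h + (-u ^ 2 + 1) * Complex.I_sq
  simpa [sub_eq_zero, add_eq_zero_iff_eq_neg] using this

theorem four_dvd_of_I_pow_eq_one {k : ℕ} (h : Complex.I ^ k = 1) : 4 ∣ k := by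
  rw [Complex.I_pow_eq_pow_mod] at h
  have hlt := Nat.mod_lt k (show 0 < 4 by norm_num)
  apply Nat.dvd_of_mod_eq_zero
  interval_cases k % 4
  · rfl
  · norm_num [Complex.ext_iff] at h
  · norm_num [Complex.ext_iff] at h
  · norm_num [Complex.ext_iff, pow_succ] at h

/-- The linear combination of three Gauss sums which evaluates the sum of `ψ (a x^4)`. -/
noncomputable def quarticPeriod (y w z u : ℂ) : ℂ := u ^ 3 * y + u ^ 2 * w + u * z

section QuarticCharacter
variable {F : Type*} [Field F]

theorem exists_pow_eq_of_forall_mem_zpowers [Finite F] {g : Fˣ}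
    (hg : ∀ u : Fˣ, u ∈ Subgroup.zpowers g) {a : F} (ha : a ≠ 0) : ∃ k : ℕ, (g : F) ^ k = a := by
  obtain ⟨k, hk⟩ := (mem_powers_iff_mem_zpowers (x := g)).mpr (hg (Units.mk0 a ha))
  exact ⟨k, by simpa using congrArg Units.val hk⟩

variable [Fintype F]

theorem card_filter_pow_four_eq [DecidableEq F] {ι : F} (hι : ι ^ 2 = -1) (h2 : (2 : F) ≠ 0)
    {x : F} (hx : x ≠ 0) : (Finset.univ.filter fun y : F => y ^ 4 = x ^ 4).card = 4 := by
  have hι1 : ι ≠ 1 := by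
    rintro rfl
    exact h2 (by linear_combination hι)
  have hι2 : ι ≠ -1 := by
    rintro rfl
    exact h2 (by linear_combination hι)
  have hι0 : ι ≠ 0 := by
    rintro rfl
    simp at hι
  have hs : (Finset.univ.filter fun y : F => y ^ 4 = x ^ 4) = {x, -x, ι * x, -(ι * x)} := by
    ext y
    simp only [Finset.mem_filter, Finset.mem_univ, true_and, Finset.mem_insert,
      Finset.mem_singleton]
    have hf : y ^ 4 - x ^ 4 = (y - x) * ((y + x) * ((y - ι * x) * (y + ι * x))) := by
      linear_combination (x ^ 2 * (y ^ 2 - x ^ 2)) * hι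
    rw [← sub_eq_zero, hf]
    simp [sub_eq_zero, add_eq_zero_iff_eq_neg]
  have hneg : ∀ a : F, a ≠ 0 → a ≠ -a := by
    intro a ha h
    exact mul_ne_zero h2 ha (by linear_combination h)
  rw [hs]
  have e1 : x ≠ ι * x := fun h => hι1 (mul_right_cancel₀ hx (by rw [one_mul, ← h]))
  have e2 : x ≠ -(ι * x) := fun h => hι2 (mul_right_cancel₀ hx (by linear_combination h))
  rw [Finset.card_insert_of_notMem, Finset.card_insert_of_notMem, Finset.card_insert_of_notMem,
    Finset.card_singleton]
  · simpa using hneg _ (mul_ne_zero hι0 hx)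
  · simp only [Finset.mem_insert, Finset.mem_singleton, not_or, neg_inj]
    exact ⟨fun h => e2 (by rw [← h, neg_neg]), e1⟩
  · simp only [Finset.mem_insert, Finset.mem_singleton, not_or]
    exact ⟨hneg x hx, e1, e2⟩

variable {g : Fˣ} (hg : ∀ u : Fˣ, u ∈ Subgroup.zpowers g) {χ : MulChar F ℂ}
  (hχ : χ (g : F) = Complex.I)
include hg hχ

theorem apply_pow_four_of_generator {a : F} (ha : a ≠ 0) : χ a ^ 4 = 1 := by
  obtain ⟨k, rfl⟩ := exists_pow_eq_of_forall_mem_zpowers hg ha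
  rw [map_pow, hχ, ← pow_mul, mul_comm, pow_mul, Complex.I_pow_four, one_pow]

theorem pow_four_of_generator : χ ^ 4 = 1 := by
  rw [MulChar.eq_one_iff]
  intro a
  rw [MulChar.pow_apply_coe, apply_pow_four_of_generator hg hχ a.ne_zero]

theorem card_filter_pow_four_eq_sum [DecidableEq F] {ι : F} (hι : ι ^ 2 = -1) (h2 : (2 : F) ≠ 0)
    (u : F) : ((Finset.univ.filter fun x : F => x ^ 4 = u).card : ℂ) =
      1 + χ u + χ u ^ 2 + χ u ^ 3 := by
  -- At u = 0 there is the single solution 0, and χ(0) = 0.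
  rcases eq_or_ne u 0 with rfl | hu
  · simp [Finset.filter_eq', MulChar.map_zero]
  have h4 := apply_pow_four_of_generator hg hχ hu
  by_cases h1 : χ u = 1
  · obtain ⟨k, rfl⟩ := exists_pow_eq_of_forall_mem_zpowers hg hu
    rw [map_pow, hχ] at h1
    obtain ⟨l, rfl⟩ := four_dvd_of_I_pow_eq_one h1
    rw [map_pow, hχ, h1, mul_comm, pow_mul,
      card_filter_pow_four_eq hι h2 (pow_ne_zero _ g.ne_zero)]
    norm_num
  · have h0 : 1 + χ u + χ u ^ 2 + χ u ^ 3 = 0 := by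
      apply mul_left_cancel₀ (sub_ne_zero.mpr h1)
      linear_combination h4
    rw [h0, Nat.cast_eq_zero, Finset.card_eq_zero, Finset.filter_eq_empty_iff]
    rintro x - rfl
    have hx : x ≠ 0 := by
      rintro rfl
      simp at hu
    exact h1 (by rw [map_pow, apply_pow_four_of_generator hg hχ hx])

/-- Substituting a ↦ a/b brings out φ(b)⁻¹, and χ(b)⁴ = 1 turns the inverses of χ(b), χ(b)², χ(b)³
into positive powers. -/
theorem sum_mulChar_pow_mul {ψ : AddChar F ℂ} {b : F} (hb : b ≠ 0) :
    ∑ a : F, χ a * ψ (b * a) = χ b ^ 3 * gaussSum χ ψ ∧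
    ∑ a : F, χ a ^ 2 * ψ (b * a) = χ b ^ 2 * gaussSum (χ ^ 2) ψ ∧
    ∑ a : F, χ a ^ 3 * ψ (b * a) = χ b * gaussSum (χ ^ 3) ψ := by
  have h4 := apply_pow_four_of_generator hg hχ hb
  have key : ∀ (φ : MulChar F ℂ) (r : ℂ), φ b * r = 1 →
      ∑ a : F, φ a * ψ (b * a) = r * gaussSum φ ψ := by
    intro φ r hr
    have h := gaussSum_mulShift φ ψ (Units.mk0 b hb)
    rw [Units.val_mk0] at h
    rw [← h, ← mul_assoc, mul_comm r, hr, one_mul]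
    rfl
  refine ⟨key χ _ (by linear_combination h4), ?_, ?_⟩
  · rw [← key (χ ^ 2) (χ b ^ 2) (by rw [MulChar.pow_apply' _ (by norm_num)]; linear_combination h4)]
    simp [MulChar.pow_apply']
  · rw [← key (χ ^ 3) (χ b) (by rw [MulChar.pow_apply' _ (by norm_num)]; linear_combination h4)]
    simp [MulChar.pow_apply']

/-- Group the x by u = x⁴: the number of x is 1 + χ(u) + χ(u)² + χ(u)³. The constant 1 contributes ∑
ψ(bu) = 0, the other terms the three Gauss sums. -/
theorem sum_addChar_mul_pow_four {ι : F} (hι : ι ^ 2 = -1) (h2 : (2 : F) ≠ 0)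
    {ψ : AddChar F ℂ} (hψ : ψ.IsPrimitive) {b : F} (hb : b ≠ 0) :
    ∑ x : F, ψ (b * x ^ 4) =
      quarticPeriod (gaussSum χ ψ) (gaussSum (χ ^ 2) ψ) (gaussSum (χ ^ 3) ψ) (χ b) := by
  classical
  have h0 : ∑ u : F, ψ (b * u) = 0 := by
    simp_rw [mul_comm b]
    simp [AddChar.sum_mulShift b hψ, hb]
  obtain ⟨e1, e2, e3⟩ := sum_mulChar_pow_mul hg hχ (ψ := ψ) hb
  rw [← Finset.sum_fiberwise Finset.univ (fun x : F => x ^ 4), quarticPeriod, ← e1, ← e2, ← e3,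
    ← zero_add (∑ a : F, χ a * ψ (b * a)), ← h0, ← Finset.sum_add_distrib,
    ← Finset.sum_add_distrib, ← Finset.sum_add_distrib]
  refine Finset.sum_congr rfl fun u _ => ?_
  rw [Finset.sum_congr rfl (g := fun _ => ψ (b * u))
    (fun x hx => by rw [(Finset.mem_filter.mp hx).2]), Finset.sum_const, nsmul_eq_mul,
    card_filter_pow_four_eq_sum hg hχ hι h2]
  ring

/-- The nonzero a with χ(a) = i^j form a coset of the fourth powers, each hit four times by x ↦ g^j
x⁴ with x ≠ 0. So four times the sum of ψ(ab) over that coset is P(i^j χ(b)) - 1. -/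
theorem four_mul_sum_addChar_mul [DecidableEq F] {ψ : AddChar F ℂ} (hψ : ψ.IsPrimitive) {b : F}
    (hb : b ≠ 0) (f : ℂ → ℂ) (P : ℂ → ℂ)
    (hP : P = quarticPeriod (gaussSum χ ψ) (gaussSum (χ ^ 2) ψ) (gaussSum (χ ^ 3) ψ)) :
    4 * ∑ a ∈ Finset.univ.erase (0 : F), ψ (a * b) * f (χ a) =
      (P (χ b) - 1) * f 1 + (P (Complex.I * χ b) - 1) * f Complex.I +
        (P (-χ b) - 1) * f (-1) + (P (-(Complex.I * χ b)) - 1) * f (-Complex.I) := by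
  have h0 : ∑ a ∈ Finset.univ.erase (0 : F), ψ (b * a) = -1 := by
    have h := AddChar.sum_mulShift b hψ
    simp_rw [mul_comm _ b] at h
    rw [← Finset.add_sum_erase _ _ (Finset.mem_univ (0 : F))] at h
    simp only [mul_zero, AddChar.map_zero_eq_one, hb, if_false, Nat.cast_zero] at h
    linear_combination h
  obtain ⟨e1, e2, e3⟩ := sum_mulChar_pow_mul hg hχ (ψ := ψ) hb
  rw [← Finset.add_sum_erase _ _ (Finset.mem_univ (0 : F))] at e1 e2 e3
  simp only [MulChar.map_zero, zero_mul, zero_add, ne_eq, OfNat.ofNat_ne_zero, not_false_eq_true,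
    zero_pow] at e1 e2 e3
  set I := Complex.I with hI
  have hI2 : I ^ 2 = -1 := Complex.I_sq
  -- Fourier inversion on the fourth roots of unity: f is interpolated by a cubic polynomial in
  -- χ(a).
  have hf : ∀ a ∈ Finset.univ.erase (0 : F), 4 * (ψ (a * b) * f (χ a)) =
      (f 1 + f I + f (-1) + f (-I)) * ψ (b * a) +
      (f 1 - I * f I - f (-1) + I * f (-I)) * (χ a * ψ (b * a)) +
      (f 1 - f I + f (-1) - f (-I)) * (χ a ^ 2 * ψ (b * a)) +
      (f 1 + I * f I - f (-1) - I * f (-I)) * (χ a ^ 3 * ψ (b * a)) := by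
    intro a ha
    rw [mul_comm a b]
    rcases eq_of_pow_four_eq_one
      (apply_pow_four_of_generator hg hχ (Finset.ne_of_mem_erase ha)) with h | h | h | h
    · rw [h]; ring
    · rw [h, ← hI]
      linear_combination ψ (b * a) * (-f 1 * (1 + I) + f I * (3 - I ^ 2) - f (-1) * (1 - I) -
        f (-I) * (1 - I ^ 2)) * hI2
    · rw [h]; ring
    · rw [h, ← hI]
      linear_combination ψ (b * a) * (-f 1 * (1 - I) + f (-I) * (3 - I ^ 2) - f (-1) * (1 + I) -
        f I * (1 - I ^ 2)) * hI2
  rw [Finset.mul_sum, Finset.sum_congr rfl hf, Finset.sum_add_distrib, Finset.sum_add_distrib,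
    Finset.sum_add_distrib, ← Finset.mul_sum, ← Finset.mul_sum, ← Finset.mul_sum,
    ← Finset.mul_sum, h0, e1, e2, e3, hP]
  simp only [quarticPeriod]
  linear_combination (-f I * (I * χ b ^ 3 * gaussSum χ ψ + χ b ^ 2 * gaussSum (χ ^ 2) ψ) +
    f (-I) * (I * χ b ^ 3 * gaussSum χ ψ - χ b ^ 2 * gaussSum (χ ^ 2) ψ)) * hI2

end QuarticCharacter

/-! ### Power sums and binomial coefficients modulo p -/

section FiniteField
variable {F : Type*} [Field F] [Fintype F]

theorem sum_pow_eq_ite {n : ℕ} (hn : n ≠ 0) :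
    ∑ x : F, x ^ n = if Fintype.card F - 1 ∣ n then -1 else 0 := by
  classical
  rw [← FiniteField.sum_pow_units F n, ← Finset.add_sum_erase _ _ (Finset.mem_univ (0 : F)),
    zero_pow hn, zero_add]
  refine Finset.sum_bij' (fun x hx => Units.mk0 x (Finset.ne_of_mem_erase hx)) (fun u _ => (u : F))
    ?_ ?_ ?_ ?_ ?_ <;> simp

theorem sum_pow_mul_one_sub_pow {a : ℕ} (ha : a ≠ 0) (b : ℕ) :
    ∑ x : F, x ^ a * (1 - x) ^ b = ∑ j ∈ Finset.range (b + 1),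
      if Fintype.card F - 1 ∣ a + j then -((-1) ^ j * (b.choose j : F)) else 0 := by
  have h : ∀ x : F, x ^ a * (1 - x) ^ b =
      ∑ j ∈ Finset.range (b + 1), (-1) ^ j * (b.choose j : F) * x ^ (a + j) := by
    intro x
    rw [sub_eq_neg_add, add_pow, Finset.mul_sum]
    refine Finset.sum_congr rfl fun j _ => ?_
    rw [neg_pow x j, one_pow, pow_add]
    ring
  simp_rw [h]
  rw [Finset.sum_comm]
  refine Finset.sum_congr rfl fun j _ => ?_
  rw [← Finset.mul_sum, sum_pow_eq_ite (by omega)]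
  split_ifs <;> simp

/-- The exponents occurring lie between f and 3f, so none is a multiple of q - 1 = 4f. -/
theorem sum_pow_mul_one_sub_pow_eq_zero {f : ℕ} (hf : f ≠ 0) (hcard : Fintype.card F - 1 = 4 * f) :
    ∑ x : F, x ^ f * (1 - x) ^ (2 * f) = 0 := by
  rw [sum_pow_mul_one_sub_pow hf]
  refine Finset.sum_eq_zero fun j hj => if_neg fun hd => ?_
  have := Nat.le_of_dvd (by omega) hd
  have := Finset.mem_range.mp hj
  omega

theorem sum_pow_three_mul_one_sub_pow {f : ℕ} (hf : f ≠ 0)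
    (hcard : Fintype.card F - 1 = 4 * f) :
    ∑ x : F, x ^ (3 * f) * (1 - x) ^ (2 * f) = -((-1) ^ f * ((2 * f).choose f : F)) := by
  -- The exponents run from 3f to 5f; only 4f, at j = f, is a multiple of q - 1.
  rw [sum_pow_mul_one_sub_pow (by omega), Finset.sum_eq_single f, if_pos]
  · rw [hcard]
    exact ⟨1, by ring⟩
  · intro j hj hne
    refine if_neg ?_
    rintro ⟨k, hk⟩
    have := Finset.mem_range.mp hj
    rw [hcard] at hk
    rcases k with _ | _ | k
    · omega
    · omega
    · have : 4 * f * (k + 1 + 1) = 4 * (f * k) + 8 * f := by ring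
      omega
  · intro h
    simp at h
    omega

end FiniteField

/-- All base-p digits of f equal d = (p-1)/4, so doubling f causes no carry. Lucas' theorem splits
off one factor C(2d, d) at a time, and p does not divide it because 2d < p. -/
theorem not_dvd_choose_of_four_mul_eq {p : ℕ} (hp : p.Prime) (hp4 : p % 4 = 1) (m : ℕ) :
    ∀ f : ℕ, 4 * f = p ^ m - 1 → ¬ p ∣ (2 * f).choose f := by
  have := Fact.mk hp
  have hp1 := hp.one_lt
  induction m with
  | zero =>
    intro f hf
    obtain rfl : f = 0 := by simpa using hf
    simpa using hp.one_lt.ne'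
  | succ m ih =>
    intro f hf
    obtain ⟨d, hd⟩ : ∃ d, p = 4 * d + 1 := ⟨p / 4, by omega⟩
    have hpm : p ^ m % 4 = 1 := by rw [Nat.pow_mod, hp4]; simp
    obtain ⟨f', hf'⟩ : ∃ f', p ^ m = 4 * f' + 1 := ⟨p ^ m / 4, by omega⟩
    have hff : f = d + p * f' := by
      rw [pow_succ, hf'] at hf
      have : (4 * f' + 1) * p = 4 * (p * f') + p := by ring
      omega
    have h2f : 2 * f = 2 * d + p * (2 * f') := by rw [hff]; ring
    have hmod : (2 * f).choose f ≡ (2 * d).choose d * (2 * f').choose f' [MOD p] := by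
      have h := Choose.choose_modEq_choose_mod_mul_choose_div_nat (n := 2 * f) (k := f) (p := p)
      rwa [h2f, hff, Nat.add_mul_mod_self_left, Nat.add_mul_mod_self_left,
        Nat.add_mul_div_left _ _ hp.pos, Nat.add_mul_div_left _ _ hp.pos,
        Nat.mod_eq_of_lt (by omega), Nat.mod_eq_of_lt (by omega), Nat.div_eq_of_lt (by omega),
        Nat.div_eq_of_lt (by omega), zero_add, zero_add, ← h2f, ← hff] at h
    rw [hmod.dvd_iff dvd_rfl, hp.dvd_mul, not_or]
    refine ⟨?_, ih f' (by omega)⟩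
    intro h
    have := hp.dvd_factorial.mp ((h.mul_right (d.factorial * (2 * d - d).factorial)).trans
      (by rw [← mul_assoc, Nat.choose_mul_factorial_mul_factorial (by omega)]))
    omega

/-! ### The quartic Jacobi sum in ℤ[i] -/

section GaussianCharacter
variable {F : Type*} [Field F] [Fintype F] {g : Fˣ} (hg : ∀ u : Fˣ, u ∈ Subgroup.zpowers g)
include hg

theorem orderOf_generator : orderOf g = Fintype.card F - 1 := by
  classical
  rw [orderOf_eq_card_of_forall_mem_zpowers hg, Nat.card_eq_fintype_card, Fintype.card_units]

theorem generator_pow_half {f : ℕ} (hf : f ≠ 0) (hcard : Fintype.card F - 1 = 4 * f) :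
    (g : F) ^ (2 * f) = -1 := by
  have h1 : ((g : F) ^ (2 * f)) ^ 2 = 1 := by
    have := pow_orderOf_eq_one g
    rw [orderOf_generator hg, hcard] at this
    rw [← pow_mul, show 2 * f * 2 = 4 * f by ring, ← Units.val_pow_eq_pow_val, this, Units.val_one]
  refine (sq_eq_sq_iff_eq_or_eq_neg.mp (h1.trans (one_pow 2).symm)).resolve_left fun h => ?_
  have h2 : g ^ (2 * f) = 1 := Units.ext (by simpa using h)
  have := Nat.le_of_dvd (by omega) (orderOf_dvd_of_pow_eq_one h2)
  rw [orderOf_generator hg] at this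
  omega

theorem exists_gaussianInt_char {f : ℕ} (hcard : Fintype.card F - 1 = 4 * f) :
    ∃ χ : MulChar F GaussianInt, χ (g : F) = ⟨0, 1⟩ := by
  classical
  let ζ : GaussianIntˣ := ⟨⟨0, 1⟩, ⟨0, -1⟩, by decide, by decide⟩
  have hζ4 : ζ ^ 4 = 1 := by
    ext <;> simp [ζ, pow_succ]
  have hζ : ζ ∈ rootsOfUnity (Fintype.card Fˣ) GaussianInt := by
    rw [mem_rootsOfUnity, Fintype.card_units, hcard, pow_mul, hζ4, one_pow]
  exact ⟨MulChar.ofRootOfUnity hζ hg, MulChar.ofRootOfUnity_spec hζ hg⟩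

variable {χ : MulChar F GaussianInt} (hχ : χ (g : F) = ⟨0, 1⟩)
include hχ

/-- J + q = ∑ (χ(x) - 1)(χ²(1-x) - 1), since the sums of χ and χ² vanish. For x ≠ 0, 1 the factors
have the form i^k - 1 and (-1)^l - 1, divisible by i - 1 and 2; at x = 0 and x = 1 the product is 0.
This congruence later fixes the real part modulo 4. -/
theorem exists_jacobiSum_add_card_eq : ∃ e : GaussianInt,
    jacobiSum χ (χ ^ 2) + (Fintype.card F : GaussianInt) = 2 * ⟨-1, 1⟩ * e := by
  have hdvd : ∀ x : F, (2 * ⟨-1, 1⟩ : GaussianInt) ∣ (χ x - 1) * ((χ ^ 2) (1 - x) - 1) := by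
    intro x
    rw [MulChar.pow_apply' _ two_ne_zero]
    rcases eq_or_ne x 0 with rfl | hx
    · simp
    rcases eq_or_ne x 1 with rfl | hx1
    · simp
    obtain ⟨k, rfl⟩ := exists_pow_eq_of_forall_mem_zpowers hg hx
    obtain ⟨l, hl⟩ := exists_pow_eq_of_forall_mem_zpowers hg (sub_ne_zero.mpr hx1.symm)
    rw [← hl, map_pow, map_pow, hχ, ← pow_mul, mul_comm l, pow_mul, mul_comm (2 : GaussianInt)]
    refine mul_dvd_mul ?_ ?_
    · have := sub_dvd_pow_sub_pow (⟨0, 1⟩ : GaussianInt) 1 k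
      rwa [one_pow] at this
    · have := sub_dvd_pow_sub_pow ((⟨0, 1⟩ : GaussianInt) ^ 2) 1 l
      rw [one_pow] at this
      refine dvd_trans ?_ this
      exact ⟨-1, by decide⟩
  have hχ1 : χ ≠ 1 := by
    intro h
    have := congrArg (fun φ : MulChar F GaussianInt => φ g) h
    simp only [hχ, MulChar.one_apply_coe] at this
    exact absurd this (by decide)
  have hχ2 : χ ^ 2 ≠ 1 := by
    intro h
    have := congrArg (fun φ : MulChar F GaussianInt => φ g) h
    simp only [MulChar.pow_apply_coe, hχ, MulChar.one_apply_coe] at this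
    exact absurd this (by decide)
  have hsum : jacobiSum χ (χ ^ 2) + (Fintype.card F : GaussianInt) =
      ∑ x : F, (χ x - 1) * ((χ ^ 2) (1 - x) - 1) := by
    have h1 := MulChar.sum_eq_zero_of_ne_one hχ1
    have h2 := MulChar.sum_eq_zero_of_ne_one hχ2
    rw [← (Equiv.subLeft (1 : F)).sum_comp] at h2
    simp only [Equiv.subLeft_apply] at h2
    have : ∀ x : F, (χ x - 1) * ((χ ^ 2) (1 - x) - 1) =
      χ x * (χ ^ 2) (1 - x) - χ x - (χ ^ 2) (1 - x) + 1 := fun x => by ring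
    simp_rw [this]
    rw [Finset.sum_add_distrib, Finset.sum_sub_distrib, Finset.sum_sub_distrib, h1, h2, jacobiSum]
    simp
  rw [hsum]
  exact Finset.dvd_sum fun x _ => hdvd x

/-- Conjugation sends i to i³, hence χ to χ³, and fixes χ². -/
theorem star_jacobiSum :
    star (jacobiSum χ (χ ^ 2)) = jacobiSum (χ ^ 3) (χ ^ 2) := by
  have h := jacobiSum_ringHomComp χ (χ ^ 2) (starRingEnd GaussianInt)
  rw [starRingEnd_apply] at h
  rw [← h]
  congr 1
  · rw [MulChar.eq_iff hg, MulChar.ringHomComp_apply, MulChar.pow_apply_coe, hχ]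
    decide
  · rw [MulChar.eq_iff hg, MulChar.ringHomComp_apply, MulChar.pow_apply_coe, hχ]
    decide

/-- The reduction of the Jacobi sum and of its conjugate in the finite field. -/
theorem jacobiSum_reduction {f : ℕ} (hf : f ≠ 0) (hcard : Fintype.card F - 1 = 4 * f) :
    ((jacobiSum χ (χ ^ 2)).re : F) + (jacobiSum χ (χ ^ 2)).im * (g : F) ^ f = 0 ∧
    ((jacobiSum χ (χ ^ 2)).re : F) - (jacobiSum χ (χ ^ 2)).im * (g : F) ^ f =
      -((-1) ^ f * ((2 * f).choose f : F)) := by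
  have hι : (g : F) ^ f * (g : F) ^ f = ((-1 : ℤ) : F) := by
    rw [← pow_add, ← two_mul, generator_pow_half hg hf hcard]
    simp
  -- The reduction ℤ[i] → F with i ↦ g^f turns χ into x ↦ x^f, so Jacobi sums become the power sums
  -- evaluated above.
  let φ : GaussianInt →+* F := Zsqrtd.lift ⟨(g : F) ^ f, hι⟩
  have hφ : ∀ a : GaussianInt, φ a = a.re + a.im * (g : F) ^ f := fun a => rfl
  have hφχ : ∀ x : F, φ (χ x) = x ^ f := by
    intro x
    rcases eq_or_ne x 0 with rfl | hx
    · simp [hf, MulChar.map_zero]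
    obtain ⟨k, rfl⟩ := exists_pow_eq_of_forall_mem_zpowers hg hx
    rw [map_pow, map_pow, hχ, hφ]
    simp [← pow_mul, mul_comm]
  constructor
  · rw [← hφ, ← sum_pow_mul_one_sub_pow_eq_zero hf hcard, jacobiSum, map_sum]
    refine Finset.sum_congr rfl fun x _ => ?_
    rw [map_mul, MulChar.pow_apply' _ two_ne_zero, map_pow, hφχ, hφχ, ← pow_mul, mul_comm f 2]
  · have : φ (star (jacobiSum χ (χ ^ 2))) =
        (jacobiSum χ (χ ^ 2)).re - (jacobiSum χ (χ ^ 2)).im * (g : F) ^ f := by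
      rw [hφ]
      simp [sub_eq_add_neg]
    rw [← this, star_jacobiSum hg hχ, ← sum_pow_three_mul_one_sub_pow hf hcard, jacobiSum, map_sum]
    refine Finset.sum_congr rfl fun x _ => ?_
    rw [map_mul, MulChar.pow_apply' _ two_ne_zero, MulChar.pow_apply' _ three_ne_zero, map_pow,
      map_pow, hφχ, hφχ, ← pow_mul, ← pow_mul, mul_comm f 2, mul_comm f 3]

end GaussianCharacter

/-! ### Relations between the Gauss sums -/

section GaussSums
variable {F : Type*} [Field F] [Fintype F] {g : Fˣ} (hg : ∀ u : Fˣ, u ∈ Subgroup.zpowers g)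
include hg

theorem mulChar_neg_one_of_generator {χ : MulChar F ℂ} (hχ : χ (g : F) = Complex.I) {f : ℕ}
    (hf : f ≠ 0) (hcard : Fintype.card F - 1 = 4 * f) : χ (-1) = (-1) ^ f := by
  rw [← generator_pow_half hg hf hcard, map_pow, hχ, pow_mul, Complex.I_sq]

/-- The relations J(χ,χ²) G(χ³) = G(χ) G(χ²) and its conjugate, multiplied by G(χ) or G(χ³), give
the two squares once G(χ) G(χ³) = χ(-1) q is known and G(χ²) is cancelled. -/
theorem gaussSum_relations {χ₀ : MulChar F GaussianInt} (hχ₀ : χ₀ (g : F) = ⟨0, 1⟩)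
    {χ : MulChar F ℂ} (hχ : χ (g : F) = Complex.I)
    {f : ℕ} (hf : f ≠ 0) (hcard : Fintype.card F - 1 = 4 * f)
    {ψ : AddChar F ℂ} (hψ : ψ.IsPrimitive) {A B : ℤ} (hJ : jacobiSum χ₀ (χ₀ ^ 2) = ⟨A, B⟩) :
    gaussSum (χ ^ 2) ψ ^ 2 = Fintype.card F ∧
    gaussSum χ ψ * gaussSum (χ ^ 3) ψ = (-1) ^ f * gaussSum (χ ^ 2) ψ ^ 2 ∧
    gaussSum χ ψ ^ 2 = (-1) ^ f * (A + B * Complex.I) * gaussSum (χ ^ 2) ψ ∧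
    gaussSum (χ ^ 3) ψ ^ 2 = (-1) ^ f * (A - B * Complex.I) * gaussSum (χ ^ 2) ψ := by
  have hcomp : χ₀.ringHomComp GaussianInt.toComplex = χ := by
    rw [MulChar.eq_iff hg, MulChar.ringHomComp_apply, hχ₀, hχ, GaussianInt.toComplex_def]
    simp
  have h4 := pow_four_of_generator hg hχ
  have hne : ∀ φ : MulChar F ℂ, φ (g : F) ≠ 1 → φ ≠ 1 := by
    rintro φ h rfl
    exact h (MulChar.one_apply_coe g)
  have hne1 : χ ≠ 1 := hne _ (by rw [hχ]; norm_num [Complex.ext_iff])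
  have hne2 : χ ^ 2 ≠ 1 := hne _ (by
    rw [MulChar.pow_apply_coe, hχ, Complex.I_sq]; norm_num)
  have hne3 : χ ^ 3 ≠ 1 := hne _ (by
    rw [MulChar.pow_apply_coe, hχ, Complex.I_pow_three]; norm_num [Complex.ext_iff])
  have hneg := mulChar_neg_one_of_generator hg hχ hf hcard
  have hsq : ((-1 : ℂ) ^ f) ^ 2 = 1 := by rw [← pow_mul, mul_comm, pow_mul]; norm_num
  have hw : gaussSum (χ ^ 2) ψ ^ 2 = Fintype.card F := by
    have hquad : (χ ^ 2).IsQuadratic := by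
      rw [MulChar.isQuadratic_iff_sq_eq_one, ← pow_mul, h4]
    rw [gaussSum_sq hne2 hquad hψ, MulChar.pow_apply' _ two_ne_zero, hneg, hsq, one_mul]
  have hyz : gaussSum χ ψ * gaussSum (χ ^ 3) ψ = (-1) ^ f * gaussSum (χ ^ 2) ψ ^ 2 := by
    have hinv : χ⁻¹ = χ ^ 3 := inv_eq_of_mul_eq_one_right (by rw [← pow_succ', h4])
    have h1 := gaussSum_mul_gaussSum_eq_card hne1 hψ
    have h2 := mul_gaussSum_inv_eq_gaussSum (χ ^ 3) ψ
    rw [MulChar.pow_apply' _ three_ne_zero, hneg] at h2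
    rw [hinv] at h1
    rw [← h2, hw, ← h1]
    linear_combination (-1) ^ f * gaussSum χ ψ * gaussSum (χ ^ 3) ψ⁻¹ * hsq
  have hw0 : gaussSum (χ ^ 2) ψ ≠ 0 := by
    intro h
    rw [h] at hw
    have : Fintype.card F ≠ 0 := Fintype.card_ne_zero
    apply this
    exact_mod_cast hw.symm.trans (zero_pow two_ne_zero)
  have hj1 : jacobiSum χ (χ ^ 2) = A + B * Complex.I := by
    rw [← hcomp, MulChar.ringHomComp_pow, jacobiSum_ringHomComp, hJ, GaussianInt.toComplex_def]
  have hj2 : jacobiSum (χ ^ 3) (χ ^ 2) = A - B * Complex.I := by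
    rw [← hcomp, MulChar.ringHomComp_pow, MulChar.ringHomComp_pow, jacobiSum_ringHomComp,
      ← star_jacobiSum hg hχ₀, hJ, GaussianInt.toComplex_def]
    simp [sub_eq_add_neg]
  have e1 := jacobiSum_mul_nontrivial (χ := χ) (φ := χ ^ 2) (by rwa [← pow_succ']) ψ
  have e2 := jacobiSum_mul_nontrivial (χ := χ ^ 3) (φ := χ ^ 2)
    (by rwa [← pow_add, pow_succ, h4, one_mul]) ψ
  rw [← pow_succ', hj1] at e1
  rw [← pow_add, pow_succ, h4, one_mul, hj2] at e2
  refine ⟨hw, hyz, mul_right_cancel₀ hw0 ?_, mul_right_cancel₀ hw0 ?_⟩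
  · linear_combination -gaussSum χ ψ * e1 + (A + B * Complex.I) * hyz
  · linear_combination -gaussSum (χ ^ 3) ψ * e2 + (A - B * Complex.I) * hyz

end GaussSums

/-! ### The parameters s and t -/

theorem dvd_of_dvd_sq_add_sq {p : ℕ} (hp : p.Prime) (hp4 : p % 4 = 3) {a b : ℤ}
    (h : (p : ℤ) ∣ a ^ 2 + b ^ 2) : (p : ℤ) ∣ a := by
  have := Fact.mk hp
  have hz : (a : ZMod p) ^ 2 = -(b : ZMod p) ^ 2 := by
    rw [← ZMod.intCast_zmod_eq_zero_iff_dvd] at h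
    push_cast at h
    linear_combination h
  rw [← ZMod.intCast_zmod_eq_zero_iff_dvd]
  by_contra ha
  have hb : (b : ZMod p) ≠ 0 := by
    intro hb
    rw [hb] at hz
    exact ha (by simpa using hz)
  exact ZMod.mod_four_ne_three_of_sq_eq_neg_sq' hb hz hp4

/-- Descent: since -1 is not a square modulo p, p divides both a and b, and p² can be cancelled. -/
theorem sq_add_sq_eq_pow {p : ℕ} (hp : p.Prime) (hp4 : p % 4 = 3) (k : ℕ) :
    ∀ a b : ℤ, a ^ 2 + b ^ 2 = (p : ℤ) ^ (2 * k) →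
      (b = 0 ∧ (a = p ^ k ∨ a = -p ^ k)) ∨ (a = 0 ∧ (b = p ^ k ∨ b = -p ^ k)) := by
  induction k with
  | zero =>
    intro a b h
    rw [mul_zero, pow_zero] at h
    have ha : a ^ 2 ≤ 1 := by nlinarith
    have hb : b ^ 2 ≤ 1 := by nlinarith
    have ha1 : -1 ≤ a := by nlinarith
    have ha2 : a ≤ 1 := by nlinarith
    have hb1 : -1 ≤ b := by nlinarith
    have hb2 : b ≤ 1 := by nlinarith
    interval_cases a <;> interval_cases b <;> simp_all
  | succ k ih =>
    intro a b h
    have hd : (p : ℤ) ∣ a ^ 2 + b ^ 2 := by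
      rw [h]
      exact dvd_pow_self _ (by omega)
    obtain ⟨a', rfl⟩ := dvd_of_dvd_sq_add_sq hp hp4 hd
    obtain ⟨b', rfl⟩ := dvd_of_dvd_sq_add_sq hp hp4 (by rwa [add_comm] at hd)
    have hp0 : (p : ℤ) ≠ 0 := by exact_mod_cast hp.ne_zero
    have h' : a' ^ 2 + b' ^ 2 = (p : ℤ) ^ (2 * k) := by
      apply mul_left_cancel₀ (pow_ne_zero 2 hp0)
      rw [← pow_add, show 2 + 2 * k = 2 * (k + 1) by ring, ← h]
      ring
    rcases ih a' b' h' with ⟨rfl, rfl | rfl⟩ | ⟨rfl, rfl | rfl⟩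
    · left; simp [pow_succ']
    · left; simp [pow_succ']
    · right; simp [pow_succ']
    · right; simp [pow_succ']

section Params
variable {F : Type*} [Field F] [Fintype F]

/-- For p ≡ 1 (mod 4), q divides (ss' + 4tt')(ss' - 4tt'), and the congruences make the second
factor prime to p, so ss' + 4tt' = qk. The product identity for s² + 4t² forces k = ±1 and (s',t') =
k(s,t); then s ≡ s' ≡ 1 (mod 4) gives k = 1. -/
theorem quarticParams_unique {p m q : ℕ} (hp : p.Prime) (hp2 : p ≠ 2) (hq : q = p ^ m)
    (hF : Fintype.card F = q) {f : ℕ} (hf : f ≠ 0) (hcard : q = 4 * f + 1) {g : Fˣ}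
    (hg : ∀ u : Fˣ, u ∈ Subgroup.zpowers g) {s t s' t' : ℤ}
    (h : QuarticParams p m q g s t) (h' : QuarticParams p m q g s' t') : s = s' ∧ t = t' := by
  have := Fact.mk hp
  have hodd := hp.eq_two_or_odd
  rcases (show p % 4 = 1 ∨ p % 4 = 3 by omega) with hp4 | hp4
  swap
  · obtain ⟨rfl, rfl⟩ := h.2 hp4
    obtain ⟨rfl, rfl⟩ := h'.2 hp4
    exact ⟨rfl, rfl⟩
  obtain ⟨hn, hgcd, hs, ht⟩ := h.1 hp4
  obtain ⟨hn', hgcd', hs', ht'⟩ := h'.1 hp4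
  have hchar : CharP F p := charP_of_card_eq_prime_pow (hF.trans hq)
  have hι := generator_pow_half hg hf (by omega : Fintype.card F - 1 = 4 * f)
  have h3 : 3 * (q - 1) / 4 = 3 * f := by omega
  rw [h3] at ht ht'
  have hne : ∀ n : ℤ, Int.gcd p n = 1 → (n : F) ≠ 0 := by
    intro n hn h0
    rw [CharP.intCast_eq_zero_iff F p, ← Int.gcd_eq_left_iff_dvd (by positivity), hn] at h0
    exact hp.one_lt.ne (by exact_mod_cast h0)
  have h2 : (2 : F) ≠ 0 := by
    intro h0
    have : ((2 : ℕ) : F) = 0 := by exact_mod_cast h0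
    rw [CharP.cast_eq_zero_iff F p, Nat.prime_dvd_prime_iff_eq hp Nat.prime_two] at this
    exact hp2 this
  have hcop : IsCoprime (q : ℤ) (s * s' - 4 * t * t') := by
    rw [hq]
    push_cast
    refine IsCoprime.pow_left ((Nat.prime_iff_prime_int.mp hp).coprime_iff_not_dvd.mpr ?_)
    rw [← CharP.intCast_eq_zero_iff F p]
    push_cast
    -- Here 4tt' = ss' g^{6f} = -ss' in F.
    have : (s : F) * s' - 4 * t * t' = 2 * (s * s') := by
      linear_combination -2 * t' * ht - s * (g : F) ^ (3 * f) * ht' -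
        (s * s') * ((g : F) ^ (4 * f) - (g : F) ^ (2 * f) + 1) * hι
    rw [this]
    exact mul_ne_zero h2 (mul_ne_zero (hne s hgcd) (hne s' hgcd'))
  obtain ⟨k, hk⟩ : (q : ℤ) ∣ s * s' + 4 * t * t' := by
    refine hcop.dvd_of_dvd_mul_left ⟨s ^ 2 + s' ^ 2 - q, ?_⟩
    linear_combination (q - s' ^ 2) * hn + 4 * t ^ 2 * hn'
  have hsum : (s * s' + 4 * t * t') ^ 2 + 4 * (s * t' - s' * t) ^ 2 = (q : ℤ) ^ 2 := by
    linear_combination -q * hn - (s ^ 2 + 4 * t ^ 2) * hn'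
  have hq0 : (0 : ℤ) < q := by omega
  rw [hk] at hsum
  have hk1 : k ^ 2 ≤ 1 := by
    by_contra! hlt
    nlinarith [sq_nonneg (s * t' - s' * t), mul_pos hq0 hq0]
  have hklo : -1 ≤ k := by nlinarith
  have hkhi : k ≤ 1 := by nlinarith
  -- With k = 0 the odd number q² would be divisible by 4.
  have hk0 : k ≠ 0 := by
    rintro rfl
    have h4 : (4 : ℤ) ∣ (q : ℤ) ^ 2 := ⟨(s * t' - s' * t) ^ 2, by linear_combination -hsum⟩
    have h5 : (q : ℤ) ^ 2 = 4 * (4 * f ^ 2 + 2 * f) + 1 := by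
      rw [hcard]
      push_cast
      ring
    omega
  have hv : s * t' - s' * t = 0 := by
    have : k ^ 2 = 1 := by
      rcases (by omega : k = 1 ∨ k = -1) with rfl | rfl <;> norm_num
    have h0 : 4 * (s * t' - s' * t) ^ 2 = 0 := by
      linear_combination hsum - (q : ℤ) ^ 2 * this
    simpa using h0
  have hss : s * k = s' := mul_left_cancel₀ hq0.ne' (by
    linear_combination -s * hk + 4 * t * hv - s' * hn)
  have htt : t * k = t' := mul_left_cancel₀ hq0.ne' (by
    linear_combination -t * hk - s * hv - t' * hn)
  rcases (by omega : k = 1 ∨ k = -1) with rfl | rfl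
  · exact ⟨by omega, by omega⟩
  · rw [Int.ModEq] at hs hs'
    omega

theorem exists_normalized_jacobiSum {f : ℕ} (hf : f ≠ 0) (hcard : Fintype.card F = 4 * f + 1)
    {g : Fˣ} (hg : ∀ u : Fˣ, u ∈ Subgroup.zpowers g) :
    ∃ (s t : ℤ) (χ : MulChar F ℂ), ((Fintype.card F : ℕ) : ℤ) = s ^ 2 + 4 * t ^ 2 ∧
      s ≡ 1 [ZMOD 4] ∧ 2 * (t : F) = s * (g : F) ^ (3 * f) ∧
      ((s : F) = 0 → ((2 * f).choose f : F) = 0) ∧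
      χ (g : F) = Complex.I ∧ ∀ ψ : AddChar F ℂ, ψ.IsPrimitive →
        gaussSum (χ ^ 2) ψ ^ 2 = Fintype.card F ∧
        gaussSum χ ψ * gaussSum (χ ^ 3) ψ = (-1) ^ f * gaussSum (χ ^ 2) ψ ^ 2 ∧
        gaussSum χ ψ ^ 2 = (-s + 2 * t * Complex.I) * gaussSum (χ ^ 2) ψ ∧
        gaussSum (χ ^ 3) ψ ^ 2 = (-s - 2 * t * Complex.I) * gaussSum (χ ^ 2) ψ := by
  have hcard' : Fintype.card F - 1 = 4 * f := by omega
  obtain ⟨χ₀, hχ₀⟩ := exists_gaussianInt_char hg hcard'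
  obtain ⟨e, he⟩ := exists_jacobiSum_add_card_eq hg hχ₀
  obtain ⟨hr1, hr2⟩ := jacobiSum_reduction hg hχ₀ hf hcard'
  obtain ⟨A, B, hJ⟩ : ∃ A B : ℤ, jacobiSum χ₀ (χ₀ ^ 2) = ⟨A, B⟩ := ⟨_, _, rfl⟩
  have hχ : χ₀.ringHomComp GaussianInt.toComplex (g : F) = Complex.I := by
    rw [MulChar.ringHomComp_apply, hχ₀, GaussianInt.toComplex_def]
    simp
  have hrel := fun (ψ : AddChar F ℂ) (hψ : ψ.IsPrimitive) =>
    gaussSum_relations hg hχ₀ hχ hf hcard' hψ hJ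
  set χ := χ₀.ringHomComp GaussianInt.toComplex
  rw [hJ] at he hr1 hr2
  have hre := congrArg Zsqrtd.re he
  have him := congrArg Zsqrtd.im he
  simp [hcard] at hre him
  simp only at hr1 hr2
  -- Compare y²z² computed from the two squares with (yz)² = q².
  have hnorm : A ^ 2 + B ^ 2 = 4 * f + 1 := by
    have hψ := AddChar.FiniteField.primitiveChar_to_Complex_isPrimitive F
    set ψ := AddChar.FiniteField.primitiveChar_to_Complex F
    obtain ⟨h1, h2, h3, h4⟩ := hrel ψ hψ
    rw [h1] at h2
    have hq0 : ((Fintype.card F : ℕ) : ℂ) ≠ 0 := by simp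
    have hsq : ((-1 : ℂ) ^ f) ^ 2 = 1 := by rw [← pow_mul, mul_comm, pow_mul]; norm_num
    have : ((A : ℂ) ^ 2 + B ^ 2) = Fintype.card F := by
      apply mul_right_cancel₀ hq0
      linear_combination -(gaussSum (χ ^ 3) ψ ^ 2 * h3 +
        (-1) ^ f * (A + B * Complex.I) * gaussSum (χ ^ 2) ψ * h4 -
        (gaussSum χ ψ * gaussSum (χ ^ 3) ψ + (-1) ^ f * Fintype.card F) * h2) +
        ((Fintype.card F : ℂ) ^ 2 - (A ^ 2 + B ^ 2) * Fintype.card F) * hsq -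
        ((-1) ^ f) ^ 2 * ((A : ℂ) ^ 2 + B ^ 2) * h1 +
        ((-1) ^ f) ^ 2 * (B : ℂ) ^ 2 * gaussSum (χ ^ 2) ψ ^ 2 * Complex.I_sq
    rw [hcard] at this
    exact_mod_cast this
  have hι := generator_pow_half hg hf hcard'
  have hι3 : (g : F) ^ (3 * f) = -(g : F) ^ f := by
    rw [show 3 * f = 2 * f + f by ring, pow_add, hι, neg_one_mul]
  have hι2 : (g : F) ^ f * (g : F) ^ f = -1 := by rw [← pow_add, ← two_mul, hι]
  have hB : B = 2 * (e.re - e.im) := by linarith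
  have hBF : (B : F) = 2 * ((e.re - e.im : ℤ) : F) := by rw [hB]; push_cast; ring
  have hvan : (A : F) = 0 → ((2 * f).choose f : F) = 0 := by
    intro hA
    have h0 : (-1 : F) ^ f * ((2 * f).choose f : F) = 0 := by
      linear_combination hr1 + hr2 - 2 * hA
    simpa using h0
  -- With A = 2c + 1 and B = 2b the norm equation reads c(c+1) + b² = f, so b ≡ f (mod 2). Together
  -- with the congruence modulo 2(i-1) this gives A ≡ -1 (mod 4) for f even and A ≡ 1 for f odd.
  have hpar : (2 : ℤ) ∣ (e.re - e.im) - f := by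
    obtain ⟨c, hc⟩ : ∃ c : ℤ, A = 2 * c + 1 := ⟨-(e.re + e.im) - 2 * f - 1, by linarith⟩
    obtain ⟨b, hb⟩ : ∃ b : ℤ, e.re - e.im = b := ⟨_, rfl⟩
    rw [hb] at hB ⊢
    obtain ⟨u, hu⟩ := Int.even_mul_succ_self c
    obtain ⟨v, hv⟩ := Int.even_mul_pred_self b
    rw [hc, hB] at hnorm
    exact ⟨-u - v, by linarith⟩
  -- The choice s = -(-1)^f A, 2t = (-1)^f B makes s ≡ 1 (mod 4) and absorbs the sign χ(-1) =
  -- (-1)^f.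
  rcases Nat.even_or_odd' f with ⟨l, hl | hl⟩
  · have hε : ((-1 : ℂ) ^ f) = 1 := by rw [hl, pow_mul]; norm_num
    refine ⟨-A, e.re - e.im, χ, ?_, ?_, ?_, ?_, hχ, fun ψ hψ => ?_⟩
    · rw [hcard]
      push_cast
      linear_combination -hnorm + (B + 2 * (e.re - e.im)) * hB
    · rw [Int.ModEq]; omega
    · rw [← hBF, hι3]; push_cast
      linear_combination (-(g : F) ^ f) * hr1 + B * hι2
    · simpa using hvan
    · obtain ⟨h1, h2, h3, h4⟩ := hrel ψ hψ
      refine ⟨h1, h2, ?_, ?_⟩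
      · rw [h3, hε, hB]; push_cast; ring
      · rw [h4, hε, hB]; push_cast; ring
  · have hε : ((-1 : ℂ) ^ f) = -1 := by rw [hl, pow_succ, pow_mul]; norm_num
    refine ⟨A, -(e.re - e.im), χ, ?_, ?_, ?_, ?_, hχ, fun ψ hψ => ?_⟩
    · rw [hcard]
      push_cast
      linear_combination -hnorm + (B + 2 * (e.re - e.im)) * hB
    · rw [Int.ModEq]; omega
    · rw [Int.cast_neg, mul_neg, ← hBF, hι3]
      linear_combination ((g : F) ^ f) * hr1 - B * hι2
    · exact hvan
    · obtain ⟨h1, h2, h3, h4⟩ := hrel ψ hψ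
      refine ⟨h1, h2, ?_, ?_⟩
      · rw [h3, hε, hB]; push_cast; ring
      · rw [h4, hε, hB]; push_cast; ring

theorem exists_quarticParams {p m q : ℕ} (hp : p.Prime) (hq : q = p ^ m)
    (hF : Fintype.card F = q) {f : ℕ} (hf : f ≠ 0) (hcard : q = 4 * f + 1) {g : Fˣ}
    (hg : ∀ u : Fˣ, u ∈ Subgroup.zpowers g) :
    ∃ (s t : ℤ) (χ : MulChar F ℂ), QuarticParams p m q g s t ∧ (q : ℤ) = s ^ 2 + 4 * t ^ 2 ∧
      χ (g : F) = Complex.I ∧ ∀ ψ : AddChar F ℂ, ψ.IsPrimitive →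
        gaussSum (χ ^ 2) ψ ^ 2 = q ∧
        gaussSum χ ψ * gaussSum (χ ^ 3) ψ = (-1) ^ f * gaussSum (χ ^ 2) ψ ^ 2 ∧
        gaussSum χ ψ ^ 2 = (-s + 2 * t * Complex.I) * gaussSum (χ ^ 2) ψ ∧
        gaussSum (χ ^ 3) ψ ^ 2 = (-s - 2 * t * Complex.I) * gaussSum (χ ^ 2) ψ := by
  have := Fact.mk hp
  obtain ⟨s, t, χ, hn, hs, ht, hvan, hχ, hrel⟩ := exists_normalized_jacobiSum hf (hF.trans hcard) hg
  rw [hF] at hn hrel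
  refine ⟨s, t, χ, ⟨fun hp4 => ⟨hn, ?_, hs, ?_⟩, fun hp4 => ?_⟩, hn, hχ, hrel⟩
  · have hchar : CharP F p := charP_of_card_eq_prime_pow (hF.trans hq)
    rw [← Int.isCoprime_iff_gcd_eq_one, (Nat.prime_iff_prime_int.mp hp).coprime_iff_not_dvd,
      ← CharP.intCast_eq_zero_iff F p]
    intro h0
    have := hvan h0
    rw [CharP.cast_eq_zero_iff F p] at this
    exact not_dvd_choose_of_four_mul_eq hp hp4 m f (by omega) this
  · rw [ht]
    congr 2
    omega
  · obtain ⟨k, rfl | rfl⟩ := Nat.even_or_odd' m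
    swap
    · exfalso
      have : p ^ (2 * k + 1) % 4 = 3 := by
        rw [pow_succ, pow_mul, Nat.mul_mod, Nat.pow_mod (p ^ 2), Nat.pow_mod p, hp4]
        simp
      omega
    have hsq : s ^ 2 + (2 * t) ^ 2 = (p : ℤ) ^ (2 * k) := by
      rw [hq] at hn
      push_cast at hn
      linear_combination -hn
    -- As -p ≡ 1 (mod 4), the condition s ≡ 1 (mod 4) selects (-p)^k from ±p^k. The alternative s =
    -- 0 is excluded because s is odd.
    have hpk : (-(p : ℤ)) ^ k ≡ 1 [ZMOD 4] := by
      have : -(p : ℤ) ≡ 1 [ZMOD 4] := by rw [Int.ModEq]; omega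
      simpa using this.pow k
    rw [Int.ModEq] at hs hpk
    rw [show 2 * k / 2 = k by omega]
    rcases sq_add_sq_eq_pow hp hp4 k _ _ hsq with ⟨h0, h1⟩ | ⟨h0, -⟩
    · refine ⟨?_, by omega⟩
      rcases Nat.even_or_odd k with hk | hk
      · rw [hk.neg_pow] at hpk ⊢
        omega
      · rw [hk.neg_pow] at hpk ⊢
        omega
    · omega
end Params

/-! ### Partial fractions with the four periods -/

/-- The numerator of `∑ aⱼ Sⱼ x / (1 - Sⱼ x)` over the common denominator `∏ (1 - Sⱼ x)`. -/
def partialFractionNum {R : Type*} [CommRing R] (S₀ S₁ S₂ S₃ a₀ a₁ a₂ a₃ x : R) : R :=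
  a₀ * S₀ * x * ((1 - S₁ * x) * (1 - S₂ * x) * (1 - S₃ * x)) +
  a₁ * S₁ * x * ((1 - S₀ * x) * (1 - S₂ * x) * (1 - S₃ * x)) +
  a₂ * S₂ * x * ((1 - S₀ * x) * (1 - S₁ * x) * (1 - S₃ * x)) +
  a₃ * S₃ * x * ((1 - S₀ * x) * (1 - S₁ * x) * (1 - S₂ * x))

section PeriodPolynomial
variable {R : Type*} [CommRing R] (w α β s t q x : R)

/-- With α = y + z and β = -i(y - z), the periods at 1, i, -1, -i are w + α, -w + β, w - α, -w - β.
In the numerators below, the weights are the periods minus 1, rotated by the index of -c modulo 4.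
-/
theorem period_denominator_even (hα : α ^ 2 = 2 * q - 2 * s * w) (hβ : β ^ 2 = 2 * q + 2 * s * w)
    (hw : w ^ 2 = q) (hq : q = s ^ 2 + 4 * t ^ 2) :
    (1 - (w + α) * x) * (1 - (-w + β) * x) * (1 - (w - α) * x) * (1 - (-w - β) * x) =
      1 - 6 * q * x ^ 2 + 8 * q * s * x ^ 3 + (q ^ 2 - 4 * q * s ^ 2) * x ^ 4 := by
  grind

theorem period_numerator_even_zero (hα : α ^ 2 = 2 * q - 2 * s * w) (hβ : β ^ 2 = 2 * q + 2 * s * w)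
    (hw : w ^ 2 = q) (hq : q = s ^ 2 + 4 * t ^ 2) :
    partialFractionNum (w + α) (-w + β) (w - α) (-w - β)
      ((w + α) - 1) ((-w + β) - 1) ((w - α) - 1) ((-w - β) - 1) x =
      4 * q * (6 * s * x ^ 3 + (q - 4 * s ^ 2) * x ^ 4 +
        (3 * x - (6 * s + 3) * x ^ 2 + (-q + 4 * s ^ 2) * x ^ 3)) := by
  unfold partialFractionNum
  grind

theorem period_numerator_even_one (hα : α ^ 2 = 2 * q - 2 * s * w) (hβ : β ^ 2 = 2 * q + 2 * s * w)
    (hαβ : α * β = 4 * t * w) (hw : w ^ 2 = q) (hq : q = s ^ 2 + 4 * t ^ 2) :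
    partialFractionNum (w + α) (-w + β) (w - α) (-w - β)
      ((-w + β) - 1) ((w - α) - 1) ((-w - β) - 1) ((w + α) - 1) x =
      4 * q * (6 * s * x ^ 3 + (q - 4 * s ^ 2) * x ^ 4 +
        (-x + (2 * s + 8 * t - 3) * x ^ 2 + (-q - 8 * s * t) * x ^ 3)) := by
  unfold partialFractionNum
  grind

theorem period_numerator_even_two (hα : α ^ 2 = 2 * q - 2 * s * w) (hβ : β ^ 2 = 2 * q + 2 * s * w)
    (hw : w ^ 2 = q) (hq : q = s ^ 2 + 4 * t ^ 2) :
    partialFractionNum (w + α) (-w + β) (w - α) (-w - β)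
      ((w - α) - 1) ((-w - β) - 1) ((w + α) - 1) ((-w + β) - 1) x =
      4 * q * (6 * s * x ^ 3 + (q - 4 * s ^ 2) * x ^ 4 +
        (-x + (2 * s - 3) * x ^ 2 + (-q + 16 * t ^ 2) * x ^ 3)) := by
  unfold partialFractionNum
  grind

theorem period_numerator_even_three (hα : α ^ 2 = 2 * q - 2 * s * w) (hβ : β ^ 2 = 2 * q + 2 * s * w)
    (hαβ : α * β = 4 * t * w) (hw : w ^ 2 = q) (hq : q = s ^ 2 + 4 * t ^ 2) :
    partialFractionNum (w + α) (-w + β) (w - α) (-w - β)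
      ((-w - β) - 1) ((w + α) - 1) ((-w + β) - 1) ((w - α) - 1) x =
      4 * q * (6 * s * x ^ 3 + (q - 4 * s ^ 2) * x ^ 4 +
        (-x + (2 * s - 8 * t - 3) * x ^ 2 + (-q + 8 * s * t) * x ^ 3)) := by
  unfold partialFractionNum
  grind

theorem period_denominator_odd (hα : α ^ 2 = -(2 * q) - 2 * s * w) (hβ : β ^ 2 = -(2 * q) + 2 * s * w)
    (hw : w ^ 2 = q) (hq : q = s ^ 2 + 4 * t ^ 2) :
    (1 - (w + α) * x) * (1 - (-w + β) * x) * (1 - (w - α) * x) * (1 - (-w - β) * x) =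
      1 + 2 * q * x ^ 2 + 8 * q * s * x ^ 3 + (9 * q ^ 2 - 4 * q * s ^ 2) * x ^ 4 := by
  grind

theorem period_numerator_odd_zero (hα : α ^ 2 = -(2 * q) - 2 * s * w) (hβ : β ^ 2 = -(2 * q) + 2 * s * w)
    (hw : w ^ 2 = q) (hq : q = s ^ 2 + 4 * t ^ 2) :
    partialFractionNum (w + α) (-w + β) (w - α) (-w - β)
      ((w - α) - 1) ((-w - β) - 1) ((w + α) - 1) ((-w + β) - 1) x =
      4 * q * (6 * s * x ^ 3 + (9 * q - 4 * s ^ 2) * x ^ 4 +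
        (3 * x + (2 * s + 1) * x ^ 2 + (3 * q - 4 * s ^ 2) * x ^ 3)) := by
  unfold partialFractionNum
  grind

theorem period_numerator_odd_one (hα : α ^ 2 = -(2 * q) - 2 * s * w) (hβ : β ^ 2 = -(2 * q) + 2 * s * w)
    (hαβ : α * β = 4 * t * w) (hw : w ^ 2 = q) (hq : q = s ^ 2 + 4 * t ^ 2) :
    partialFractionNum (w + α) (-w + β) (w - α) (-w - β)
      ((-w - β) - 1) ((w + α) - 1) ((-w + β) - 1) ((w - α) - 1) x =
      4 * q * (6 * s * x ^ 3 + (9 * q - 4 * s ^ 2) * x ^ 4 +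
        (-x + (2 * s - 8 * t + 1) * x ^ 2 + (3 * q + 8 * s * t) * x ^ 3)) := by
  unfold partialFractionNum
  grind

theorem period_numerator_odd_two (hα : α ^ 2 = -(2 * q) - 2 * s * w) (hβ : β ^ 2 = -(2 * q) + 2 * s * w)
    (hw : w ^ 2 = q) (hq : q = s ^ 2 + 4 * t ^ 2) :
    partialFractionNum (w + α) (-w + β) (w - α) (-w - β)
      ((w + α) - 1) ((-w + β) - 1) ((w - α) - 1) ((-w - β) - 1) x =
      4 * q * (6 * s * x ^ 3 + (9 * q - 4 * s ^ 2) * x ^ 4 +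
        (-x + (-6 * s + 1) * x ^ 2 + (-5 * q - 16 * t ^ 2) * x ^ 3)) := by
  unfold partialFractionNum
  grind

theorem period_numerator_odd_three (hα : α ^ 2 = -(2 * q) - 2 * s * w) (hβ : β ^ 2 = -(2 * q) + 2 * s * w)
    (hαβ : α * β = 4 * t * w) (hw : w ^ 2 = q) (hq : q = s ^ 2 + 4 * t ^ 2) :
    partialFractionNum (w + α) (-w + β) (w - α) (-w - β)
      ((-w + β) - 1) ((w - α) - 1) ((-w - β) - 1) ((w + α) - 1) x =
      4 * q * (6 * s * x ^ 3 + (9 * q - 4 * s ^ 2) * x ^ 4 +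
        (-x + (2 * s + 8 * t + 1) * x ^ 2 + (3 * q - 8 * s * t) * x ^ 3)) := by
  unfold partialFractionNum
  grind

end PeriodPolynomial

/-! ### The generating series for q ≡ 1 (mod 4) -/

section QuarticSeries
variable {F : Type*} [Field F] [Fintype F]

theorem mul_prod_eq_partialFractionNum (S₀ S₁ S₂ S₃ a₀ a₁ a₂ a₃ : ℂ) (h : ℕ → ℂ)
    (hh : ∀ n, 4 * h n = a₀ * S₀ ^ n + a₁ * S₁ ^ n + a₂ * S₂ ^ n + a₃ * S₃ ^ n) :
    4 * (PowerSeries.mk fun n => if n = 0 then 0 else h n) *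
      ((1 - PowerSeries.C S₀ * PowerSeries.X) * (1 - PowerSeries.C S₁ * PowerSeries.X) *
        (1 - PowerSeries.C S₂ * PowerSeries.X) * (1 - PowerSeries.C S₃ * PowerSeries.X)) =
      partialFractionNum (PowerSeries.C S₀) (PowerSeries.C S₁) (PowerSeries.C S₂)
        (PowerSeries.C S₃) (PowerSeries.C a₀) (PowerSeries.C a₁) (PowerSeries.C a₂)
        (PowerSeries.C a₃) PowerSeries.X := by
  have hs : 4 * (PowerSeries.mk fun n => if n = 0 then 0 else h n) =
      PowerSeries.C a₀ * geomSeries S₀ + PowerSeries.C a₁ * geomSeries S₁ +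
        PowerSeries.C a₂ * geomSeries S₂ + PowerSeries.C a₃ * geomSeries S₃ := by
    ext n
    rw [← map_ofNat (PowerSeries.C (R := ℂ)) 4, PowerSeries.coeff_C_mul]
    simp only [map_add, PowerSeries.coeff_C_mul, geomSeries, PowerSeries.coeff_mk]
    split_ifs
    · ring
    · exact hh n
  have h0 := geomSeries_mul S₀
  have h1 := geomSeries_mul S₁
  have h2 := geomSeries_mul S₂
  have h3 := geomSeries_mul S₃
  rw [hs, partialFractionNum]
  generalize PowerSeries.C S₀ = T₀ at *
  generalize PowerSeries.C S₁ = T₁ at *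
  generalize PowerSeries.C S₂ = T₂ at *
  generalize PowerSeries.C S₃ = T₃ at *
  generalize (PowerSeries.X : PowerSeries ℂ) = x at *
  linear_combination
    PowerSeries.C a₀ * ((1 - T₁ * x) * (1 - T₂ * x) * (1 - T₃ * x)) * h0 +
    PowerSeries.C a₁ * ((1 - T₀ * x) * (1 - T₂ * x) * (1 - T₃ * x)) * h1 +
    PowerSeries.C a₂ * ((1 - T₀ * x) * (1 - T₁ * x) * (1 - T₃ * x)) * h2 +
    PowerSeries.C a₃ * ((1 - T₀ * x) * (1 - T₁ * x) * (1 - T₂ * x)) * h3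

/-- Since -1 = g^{2f}, the index of -c is k + 2f modulo 4; it decides which period weights which
geometric series. -/
theorem exists_quartic_series {f : ℕ} (hf : f ≠ 0) (hcard : Fintype.card F = 4 * f + 1)
    {g : Fˣ} (hg : ∀ u : Fˣ, u ∈ Subgroup.zpowers g) {s t : ℤ} {χ : MulChar F ℂ}
    (hχ : χ (g : F) = Complex.I) {ψ : AddChar F ℂ} (hψ : ψ.IsPrimitive)
    (hw : gaussSum (χ ^ 2) ψ ^ 2 = Fintype.card F)
    (hyz : gaussSum χ ψ * gaussSum (χ ^ 3) ψ = (-1) ^ f * gaussSum (χ ^ 2) ψ ^ 2)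
    (hy : gaussSum χ ψ ^ 2 = (-s + 2 * t * Complex.I) * gaussSum (χ ^ 2) ψ)
    (hz : gaussSum (χ ^ 3) ψ ^ 2 = (-s - 2 * t * Complex.I) * gaussSum (χ ^ 2) ψ) (k : ℕ) :
    ∃ (w α β H : PowerSeries ℂ), α ^ 2 = (-1) ^ f * (2 * (Fintype.card F : ℕ)) - 2 * s * w ∧
      β ^ 2 = (-1) ^ f * (2 * (Fintype.card F : ℕ)) + 2 * s * w ∧ α * β = 4 * t * w ∧
      w ^ 2 = (Fintype.card F : ℕ) ∧
      (((Fintype.card F : ℕ) : PowerSeries ℂ) *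
        PowerSeries.map (algebraMap ℚ ℂ) (quarticGenFun F ((g : F) ^ k)) =
          geomSeries (Fintype.card F : ℕ) + H) ∧
      ∃ a₀ a₁ a₂ a₃ : PowerSeries ℂ,
        4 * H * ((1 - (w + α) * PowerSeries.X) * (1 - (-w + β) * PowerSeries.X) *
          (1 - (w - α) * PowerSeries.X) * (1 - (-w - β) * PowerSeries.X)) =
          partialFractionNum (w + α) (-w + β) (w - α) (-w - β) a₀ a₁ a₂ a₃ PowerSeries.X ∧
        ((k + 2 * f) % 4 = 0 →
          a₀ = w + α - 1 ∧ a₁ = -w + β - 1 ∧ a₂ = w - α - 1 ∧ a₃ = -w - β - 1) ∧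
        ((k + 2 * f) % 4 = 1 →
          a₀ = -w + β - 1 ∧ a₁ = w - α - 1 ∧ a₂ = -w - β - 1 ∧ a₃ = w + α - 1) ∧
        ((k + 2 * f) % 4 = 2 →
          a₀ = w - α - 1 ∧ a₁ = -w - β - 1 ∧ a₂ = w + α - 1 ∧ a₃ = -w + β - 1) ∧
        ((k + 2 * f) % 4 = 3 →
          a₀ = -w - β - 1 ∧ a₁ = w + α - 1 ∧ a₂ = -w + β - 1 ∧ a₃ = w - α - 1) := by
  classical
  have hcard' : Fintype.card F - 1 = 4 * f := by omega
  obtain ⟨ι, hι, h2⟩ : ∃ ι : F, ι ^ 2 = -1 ∧ (2 : F) ≠ 0 := by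
    refine ⟨(g : F) ^ f, by rw [← pow_mul, mul_comm, generator_pow_half hg hf hcard'], ?_⟩
    intro h0
    -- If 2 = 0 in F, then q = 4f + 1 would equal both 0 and 1 there.
    have h1 := FiniteField.cast_card_eq_zero F
    rw [hcard] at h1
    push_cast at h1
    exact one_ne_zero (α := F) (by linear_combination h1 - 2 * f * h0)
  set P : ℂ → ℂ :=
    quarticPeriod (gaussSum χ ψ) (gaussSum (χ ^ 2) ψ) (gaussSum (χ ^ 3) ψ) with hP
  set y := gaussSum χ ψ
  set w := gaussSum (χ ^ 2) ψ
  set z := gaussSum (χ ^ 3) ψ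
  set I := Complex.I
  have hI : I ^ 2 = -1 := Complex.I_sq
  set c : F := (g : F) ^ k with hc
  have hc0 : -c ≠ 0 := neg_ne_zero.mpr (pow_ne_zero _ g.ne_zero)
  have hv : χ (-c) = I ^ ((k + 2 * f) % 4) := by
    rw [← Complex.I_pow_eq_pow_mod, neg_eq_neg_one_mul, map_mul,
      mulChar_neg_one_of_generator hg hχ hf hcard', hc, map_pow, hχ, pow_add, pow_mul _ 2 f,
      Complex.I_sq, mul_comm]
  set v := χ (-c)
  have hP1 : P 1 = w + (y + z) := by simp only [hP, quarticPeriod]; ring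
  have hPI : P I = -w + -I * (y - z) := by
    simp only [hP, quarticPeriod]; linear_combination (I * y + w) * hI
  have hPn : P (-1) = w - (y + z) := by simp only [hP, quarticPeriod]; ring
  have hPnI : P (-I) = -w - -I * (y - z) := by
    simp only [hP, quarticPeriod]; linear_combination (-I * y + w) * hI
  set h : ℕ → ℂ := fun n => ∑ a ∈ Finset.univ.erase (0 : F), ψ (a * -c) * P (χ a) ^ n with hh
  have hH := card_mul_map_quarticGenFun c h fun n _ => by
    rw [card_mul_quarticCount_eq_add hψ, hh]
    congr 1
    refine Finset.sum_congr rfl fun a ha => ?_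
    rw [sum_addChar_mul_pow_four hg hχ hι h2 hψ (Finset.ne_of_mem_erase ha)]
  have hh4 : ∀ n, 4 * h n = (P v - 1) * (w + (y + z)) ^ n +
      (P (I * v) - 1) * (-w + -I * (y - z)) ^ n + (P (-v) - 1) * (w - (y + z)) ^ n +
      (P (-(I * v)) - 1) * (-w - -I * (y - z)) ^ n := by
    intro n
    rw [← hP1, ← hPI, ← hPn, ← hPnI]
    exact four_mul_sum_addChar_mul hg hχ hψ hc0 (fun u => P u ^ n) P hP
  have hN := mul_prod_eq_partialFractionNum _ _ _ _ _ _ _ _ h hh4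
  have hα : (y + z) ^ 2 = (-1) ^ f * (2 * (Fintype.card F : ℕ)) - 2 * s * w := by
    linear_combination hy + hz + 2 * hyz + 2 * (-1) ^ f * hw
  have hβ : (-I * (y - z)) ^ 2 = (-1) ^ f * (2 * (Fintype.card F : ℕ)) + 2 * s * w := by
    linear_combination -hy - hz + 2 * hyz + 2 * (-1) ^ f * hw + (y - z) ^ 2 * hI
  have hαβ : (y + z) * (-I * (y - z)) = 4 * t * w := by
    linear_combination -I * hy + I * hz - 4 * t * w * hI
  refine ⟨PowerSeries.C w, PowerSeries.C (y + z), PowerSeries.C (-I * (y - z)), _, ?_, ?_, ?_, ?_,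
    hH, PowerSeries.C (P v - 1), PowerSeries.C (P (I * v) - 1), PowerSeries.C (P (-v) - 1),
    PowerSeries.C (P (-(I * v)) - 1), ?_, ?_, ?_, ?_, ?_⟩
  · rw [← map_pow, hα]
    simp only [map_sub, map_mul, map_ofNat, map_intCast, map_natCast, map_pow, map_neg, map_one]
  · rw [← map_pow, hβ]
    simp only [map_add, map_mul, map_ofNat, map_intCast, map_natCast, map_pow, map_neg, map_one]
  · rw [← map_mul, hαβ]
    simp only [map_mul, map_ofNat, map_intCast]
  · rw [← map_pow, hw]; simp
  · simpa only [map_add, map_sub, map_neg] using hN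
  all_goals
    intro hk
    rw [hk] at hv
    simp only [← map_add, ← map_sub, ← map_neg, ← map_one (PowerSeries.C (R := ℂ))]
    rw [← hP1, ← hPI, ← hPn, ← hPnI, hv]
  · simp
  · have e : I * I = -1 := by rw [← pow_two, hI]
    simp [e]
  · have e : I * -1 = -I := by ring
    simp [hI]
  · have e : I ^ 3 = -I := by linear_combination I * hI
    have e' : I * -I = 1 := by linear_combination -hI
    simp [e, e']

end QuarticSeries

/-! ### The generating series for q ≡ 3 (mod 4) -/

section QuadraticSeries
variable {F : Type*} [Field F] [Fintype F]

theorem sum_sq_eq_sum_mul [DecidableEq F] (hF2 : ringChar F ≠ 2) (h : F → ℂ) :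
    ∑ x : F, h (x ^ 2) = ∑ u : F, (1 + (quadraticChar F u : ℂ)) * h u := by
  rw [← Finset.sum_fiberwise Finset.univ (fun x : F => x ^ 2)]
  refine Finset.sum_congr rfl fun u _ => ?_
  rw [Finset.sum_congr rfl (g := fun _ => h u)
    (fun x hx => by rw [(Finset.mem_filter.mp hx).2]), Finset.sum_const, nsmul_eq_mul]
  congr 1
  have := quadraticChar_card_sqrts hF2 u
  rw [add_comm]
  rw [show {x : F | x ^ 2 = u}.toFinset = Finset.univ.filter fun x : F => x ^ 2 = u by
    ext; simp] at this
  exact_mod_cast congrArg (Int.cast : ℤ → ℂ) this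

theorem quadraticChar_neg_of_card [DecidableEq F] (hcard : Fintype.card F % 4 = 3) (u : F) :
    quadraticChar F (-u) = -quadraticChar F u := by
  have h1 : quadraticChar F (-1) = -1 := by
    rw [quadraticChar_neg_one_iff_not_isSquare, FiniteField.isSquare_neg_one_iff]
    exact not_not_intro hcard
  rw [neg_eq_neg_one_mul, map_mul, h1, neg_one_mul]

theorem ringChar_ne_two_of_card (hcard : Fintype.card F % 4 = 3) : ringChar F ≠ 2 := by
  intro h
  have := FiniteField.even_card_iff_char_two.mp h
  omega

/-- Applying the count of square roots to x⁴ = (x²)² leaves an extra sum of the quadratic character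
times an even function. It vanishes because the character is odd when q ≡ 3 (mod 4). -/
theorem sum_pow_four_eq_sum_mul [DecidableEq F] (hcard : Fintype.card F % 4 = 3) (h : F → ℂ) :
    ∑ x : F, h (x ^ 4) = ∑ u : F, (1 + (quadraticChar F u : ℂ)) * h u := by
  have hF2 := ringChar_ne_two_of_card hcard
  have h1 := sum_sq_eq_sum_mul hF2 fun u => h (u ^ 2)
  simp only [← pow_mul, Nat.reduceMul] at h1
  rw [h1]
  have h0 : ∑ u : F, (quadraticChar F u : ℂ) * h (u ^ 2) = 0 := by
    have : ∑ u : F, (quadraticChar F u : ℂ) * h (u ^ 2) =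
        -∑ u : F, (quadraticChar F u : ℂ) * h (u ^ 2) := by
      conv_lhs => rw [← Equiv.sum_comp (Equiv.neg F)]
      rw [← Finset.sum_neg_distrib]
      refine Finset.sum_congr rfl fun u _ => ?_
      rw [Equiv.neg_apply, quadraticChar_neg_of_card hcard, neg_sq]
      push_cast
      ring
    exact self_eq_neg.mp this
  have h2 := sum_sq_eq_sum_mul hF2 h
  simp only [add_mul, one_mul, Finset.sum_add_distrib, h0, add_zero] at h2 ⊢
  exact h2

theorem exists_quadratic_gaussSum [DecidableEq F] (hcard : Fintype.card F % 4 = 3)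
    {ψ : AddChar F ℂ} (hψ : ψ.IsPrimitive) : ∃ w : ℂ, w ^ 2 = -(Fintype.card F : ℂ) ∧
      ∀ b : F, ∑ a : F, (quadraticChar F a : ℂ) * ψ (b * a) = quadraticChar F b * w := by
  have hF2 := ringChar_ne_two_of_card hcard
  set ρ : MulChar F ℂ := (quadraticChar F).ringHomComp (Int.castRingHom ℂ) with hρ
  have hρa : ∀ a, ρ a = (quadraticChar F a : ℂ) := fun a => rfl
  have hne : ρ ≠ 1 := (MulChar.ringHomComp_ne_one_iff (RingHom.injective_int _)).mpr
    (quadraticChar_ne_one hF2)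
  refine ⟨gaussSum ρ ψ, ?_, fun b => ?_⟩
  · rw [gaussSum_sq hne ((quadraticChar_isQuadratic F).comp _) hψ, hρa,
      quadraticChar_neg_of_card hcard]
    simp
  · rcases eq_or_ne b 0 with rfl | hb
    · have := MulChar.sum_eq_zero_of_ne_one hne
      simpa [hρa] using this
    · have h := gaussSum_mulShift ρ ψ (Units.mk0 b hb)
      rw [Units.val_mk0, hρa] at h
      have hb1 : (quadraticChar F b : ℂ) * quadraticChar F b = 1 := by
        have := quadraticChar_sq_one hb
        rw [pow_two] at this
        exact_mod_cast this
      rw [← h, ← mul_assoc, hb1, one_mul]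
      rfl

theorem exists_quadratic_series [DecidableEq F] (hcard : Fintype.card F % 4 = 3) (c : F) :
    ∃ H : PowerSeries ℂ,
      ((Fintype.card F : ℕ) : PowerSeries ℂ) *
        PowerSeries.map (algebraMap ℚ ℂ) (quarticGenFun F c) =
          geomSeries (Fintype.card F : ℕ) + H ∧
      H * (1 + ((Fintype.card F : ℕ) : PowerSeries ℂ) * PowerSeries.X ^ 2) =
        ((Fintype.card F : ℕ) : PowerSeries ℂ) * ((quadraticChar F c : PowerSeries ℂ) * PowerSeries.X +
          (if c = 0 then 1 - ((Fintype.card F : ℕ) : PowerSeries ℂ) else 1) *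
            PowerSeries.X ^ 2) := by
  have hψ := AddChar.FiniteField.primitiveChar_to_Complex_isPrimitive F
  set ψ := AddChar.FiniteField.primitiveChar_to_Complex F
  obtain ⟨w, hw, hsum⟩ := exists_quadratic_gaussSum hcard hψ
  set T : ℂ := if c = 0 then 1 - (Fintype.card F : ℂ) else 1 with hT
  have hψsum : ∀ b : F, ∑ a : F, ψ (b * a) = if b = 0 then (Fintype.card F : ℂ) else 0 := by
    intro b
    have := AddChar.sum_mulShift b hψ
    simp_rw [mul_comm _ b] at this
    rw [this]
    split_ifs <;> simp
  have h0 : ∑ a ∈ Finset.univ.erase (0 : F), ψ (a * -c) = -T := by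
    have h := hψsum (-c)
    simp_rw [mul_comm (-c)] at h
    rw [← Finset.add_sum_erase _ _ (Finset.mem_univ (0 : F)), zero_mul,
      AddChar.map_zero_eq_one] at h
    simp only [neg_eq_zero] at h
    rw [eq_sub_of_add_eq' h, hT]
    split_ifs <;> ring
  have h1 : ∑ a ∈ Finset.univ.erase (0 : F), (quadraticChar F a : ℂ) * ψ (a * -c) =
      -quadraticChar F c * w := by
    have h := hsum (-c)
    simp_rw [mul_comm (-c)] at h
    rw [← Finset.add_sum_erase _ _ (Finset.mem_univ (0 : F)),
      quadraticChar_neg_of_card hcard] at h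
    simpa using h
  set h : ℕ → ℂ := fun n => ∑ a ∈ Finset.univ.erase (0 : F),
    ψ (a * -c) * (quadraticChar F a * w) ^ n with hh
  have hH := card_mul_map_quarticGenFun c h fun n _ => by
    rw [card_mul_quarticCount_eq_add hψ, hh]
    congr 1
    refine Finset.sum_congr rfl fun a ha => ?_
    rw [sum_pow_four_eq_sum_mul hcard (fun u => ψ (a * u))]
    simp only [add_mul, one_mul, Finset.sum_add_distrib, hsum, hψsum,
      Finset.ne_of_mem_erase ha, if_false, zero_add]
  refine ⟨_, hH, ?_⟩
  -- As the quadratic character takes the values ±1 on a ≠ 0, its product with w, raised to the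
  -- power n, splits into the even and odd parts of w^n.
  have hn : ∀ n, 2 * h n = (-T - quadraticChar F c * w) * w ^ n +
      (-T + quadraticChar F c * w) * (-w) ^ n := by
    intro n
    have hterm : ∀ a ∈ Finset.univ.erase (0 : F),
        2 * (ψ (a * -c) * (quadraticChar F a * w) ^ n) =
        (w ^ n + (-w) ^ n) * ψ (a * -c) +
          (w ^ n - (-w) ^ n) * (quadraticChar F a * ψ (a * -c)) := by
      intro a ha
      rcases quadraticChar_dichotomy (Finset.ne_of_mem_erase ha) with h | h
      · rw [h]; push_cast; rw [one_mul]; ring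
      · rw [h]; push_cast; rw [neg_one_mul]; ring
    rw [hh]
    simp only
    rw [Finset.mul_sum, Finset.sum_congr rfl hterm, Finset.sum_add_distrib, ← Finset.mul_sum,
      ← Finset.mul_sum, h0, h1]
    ring
  have hs : 2 * (PowerSeries.mk fun n => if n = 0 then 0 else h n) =
      PowerSeries.C (-T - quadraticChar F c * w) * geomSeries w +
        PowerSeries.C (-T + quadraticChar F c * w) * geomSeries (-w) := by
    ext n
    rw [← map_ofNat (PowerSeries.C (R := ℂ)) 2, PowerSeries.coeff_C_mul]
    rw [map_add]
    simp only [PowerSeries.coeff_C_mul, geomSeries, PowerSeries.coeff_mk]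
    split_ifs
    · ring
    · exact hn n
  have g1 := geomSeries_mul w
  have g2 := geomSeries_mul (-w)
  have hCw : PowerSeries.C w ^ 2 = -((Fintype.card F : ℕ) : PowerSeries ℂ) := by
    rw [← map_pow, hw, map_neg, map_natCast]
  have hCT : PowerSeries.C T =
      if c = 0 then 1 - ((Fintype.card F : ℕ) : PowerSeries ℂ) else 1 := by
    rw [hT]
    split_ifs
    · rw [map_sub, map_natCast, map_one]
    · rw [map_one]
  rw [← hCT]
  simp only [map_sub, map_add, map_mul, map_neg, map_intCast] at hs g1 g2
  have h2 := powerSeries_natCast_ne_zero two_ne_zero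
  push_cast at h2
  apply mul_left_cancel₀ h2
  generalize PowerSeries.C w = W at *
  generalize PowerSeries.C T = U at *
  generalize (PowerSeries.mk fun n => if n = 0 then 0 else h n) = H at *
  generalize (PowerSeries.X : PowerSeries ℂ) = x at *
  generalize geomSeries w = G₁ at *
  generalize geomSeries (-w) = G₂ at *
  generalize ((quadraticChar F c : ℤ) : PowerSeries ℂ) = r at *
  generalize ((Fintype.card F : ℕ) : PowerSeries ℂ) = q at *
  linear_combination (1 - W * x) * (1 + W * x) * hs + (-U - r * W) * (1 + W * x) * g1 +
    (-U + r * W) * (1 - W * x) * g2 + (2 * H * x ^ 2 - 2 * r * x - 2 * U * x ^ 2) * hCw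

end QuadraticSeries

/-! ### Assembling the generating functions -/

section GeneratingFunctions
open Polynomial
variable {F : Type*} [Field F] [Fintype F]

theorem quarticGenFun_eq_of_even {q f : ℕ} (hF : Fintype.card F = q) (hf0 : f ≠ 0)
    (hf : q = 4 * f + 1) {g : Fˣ} (hg : ∀ u : Fˣ, u ∈ Subgroup.zpowers g) {s t : ℤ}
    {χ : MulChar F ℂ} (hn : (q : ℤ) = s ^ 2 + 4 * t ^ 2) (hχ : χ (g : F) = Complex.I)
    (hrel : ∀ ψ : AddChar F ℂ, ψ.IsPrimitive →
      gaussSum (χ ^ 2) ψ ^ 2 = q ∧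
      gaussSum χ ψ * gaussSum (χ ^ 3) ψ = (-1) ^ f * gaussSum (χ ^ 2) ψ ^ 2 ∧
      gaussSum χ ψ ^ 2 = (-s + 2 * t * Complex.I) * gaussSum (χ ^ 2) ψ ∧
      gaussSum (χ ^ 3) ψ ^ 2 = (-s - 2 * t * Complex.I) * gaussSum (χ ^ 2) ψ)
    (hpar : Even f) (k : ℕ) :
    quarticGenFun F ((g : F) ^ k) =
      expandFrac X (1 - (q : ℚ[X]) * X) +
      expandFrac
        (6 * (s : ℚ[X]) * X ^ 3 + ((q : ℚ[X]) - 4 * (s : ℚ[X]) ^ 2) * X ^ 4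
          + quarticB1 q s t k)
        (1 - 6 * (q : ℚ[X]) * X ^ 2 + 8 * (q : ℚ[X]) * (s : ℚ[X]) * X ^ 3
          + ((q : ℚ[X]) ^ 2 - 4 * (q : ℚ[X]) * (s : ℚ[X]) ^ 2) * X ^ 4) := by
  have h4 := powerSeries_natCast_ne_zero four_ne_zero
  push_cast at h4
  have hψ := AddChar.FiniteField.primitiveChar_to_Complex_isPrimitive F
  obtain ⟨hw, hyz, hy, hz⟩ := hrel _ hψ
  rw [← hF] at hw
  obtain ⟨w, α, β, H, hα, hβ, hαβ, hw, hH, a₀, a₁, a₂, a₃, hD, ha0, ha1, ha2, ha3⟩ :=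
    exists_quartic_series hf0 (hF.trans hf) hg hχ hψ hw hyz hy hz k
  rw [hF] at hα hβ hw hH
  have hnS : (q : PowerSeries ℂ) = (s : PowerSeries ℂ) ^ 2 + 4 * (t : PowerSeries ℂ) ^ 2 := by
    exact_mod_cast congrArg (Int.cast : ℤ → PowerSeries ℂ) hn
  have hq0 : q ≠ 0 := by omega
  have hk := Nat.mod_lt k (show 0 < 4 by norm_num)
  have hε : (-1 : PowerSeries ℂ) ^ f = 1 := hpar.neg_one_pow
  rw [hε, one_mul] at hα hβ
  refine eq_expandFrac_add_expandFrac hq0 _ _ _ (by simp) H hH (mul_left_cancel₀ h4 ?_)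
  have hden := period_denominator_even w α β s t q PowerSeries.X hα hβ hw hnS
  simp only [quarticB1, apply_ite polyToSeries, map_add, map_sub, map_mul, map_pow, map_neg,
    map_natCast, map_intCast, map_ofNat, map_one, polyToSeries_X]
  rw [← hden, ← mul_assoc, hD, ← mul_assoc]
  rw [Nat.even_iff] at hpar
  interval_cases hk4 : k % 4
  · obtain ⟨rfl, rfl, rfl, rfl⟩ := ha0 (by omega)
    have hnum := period_numerator_even_zero w α β s t q PowerSeries.X hα hβ hw hnS
    exact hnum
  · obtain ⟨rfl, rfl, rfl, rfl⟩ := ha1 (by omega)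
    have hnum := period_numerator_even_one w α β s t q PowerSeries.X hα hβ hαβ hw hnS
    exact hnum
  · obtain ⟨rfl, rfl, rfl, rfl⟩ := ha2 (by omega)
    have hnum := period_numerator_even_two w α β s t q PowerSeries.X hα hβ hw hnS
    exact hnum
  · obtain ⟨rfl, rfl, rfl, rfl⟩ := ha3 (by omega)
    have hnum := period_numerator_even_three w α β s t q PowerSeries.X hα hβ hαβ hw hnS
    exact hnum

theorem quarticGenFun_eq_of_odd {q f : ℕ} (hF : Fintype.card F = q) (hf0 : f ≠ 0)
    (hf : q = 4 * f + 1) {g : Fˣ} (hg : ∀ u : Fˣ, u ∈ Subgroup.zpowers g) {s t : ℤ}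
    {χ : MulChar F ℂ} (hn : (q : ℤ) = s ^ 2 + 4 * t ^ 2) (hχ : χ (g : F) = Complex.I)
    (hrel : ∀ ψ : AddChar F ℂ, ψ.IsPrimitive →
      gaussSum (χ ^ 2) ψ ^ 2 = q ∧
      gaussSum χ ψ * gaussSum (χ ^ 3) ψ = (-1) ^ f * gaussSum (χ ^ 2) ψ ^ 2 ∧
      gaussSum χ ψ ^ 2 = (-s + 2 * t * Complex.I) * gaussSum (χ ^ 2) ψ ∧
      gaussSum (χ ^ 3) ψ ^ 2 = (-s - 2 * t * Complex.I) * gaussSum (χ ^ 2) ψ)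
    (hpar : Odd f) (k : ℕ) :
    quarticGenFun F ((g : F) ^ k) =
      expandFrac X (1 - (q : ℚ[X]) * X) +
      expandFrac
        (6 * (s : ℚ[X]) * X ^ 3 + (9 * (q : ℚ[X]) - 4 * (s : ℚ[X]) ^ 2) * X ^ 4
          + quarticB2 q s t k)
        (1 + 2 * (q : ℚ[X]) * X ^ 2 + 8 * (q : ℚ[X]) * (s : ℚ[X]) * X ^ 3
          + (9 * (q : ℚ[X]) ^ 2 - 4 * (q : ℚ[X]) * (s : ℚ[X]) ^ 2) * X ^ 4) := by
  have h4 := powerSeries_natCast_ne_zero four_ne_zero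
  push_cast at h4
  have hψ := AddChar.FiniteField.primitiveChar_to_Complex_isPrimitive F
  obtain ⟨hw, hyz, hy, hz⟩ := hrel _ hψ
  rw [← hF] at hw
  obtain ⟨w, α, β, H, hα, hβ, hαβ, hw, hH, a₀, a₁, a₂, a₃, hD, ha0, ha1, ha2, ha3⟩ :=
    exists_quartic_series hf0 (hF.trans hf) hg hχ hψ hw hyz hy hz k
  rw [hF] at hα hβ hw hH
  have hnS : (q : PowerSeries ℂ) = (s : PowerSeries ℂ) ^ 2 + 4 * (t : PowerSeries ℂ) ^ 2 := by
    exact_mod_cast congrArg (Int.cast : ℤ → PowerSeries ℂ) hn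
  have hq0 : q ≠ 0 := by omega
  have hk := Nat.mod_lt k (show 0 < 4 by norm_num)
  have hε : (-1 : PowerSeries ℂ) ^ f = -1 := hpar.neg_one_pow
  rw [hε, neg_one_mul] at hα hβ
  refine eq_expandFrac_add_expandFrac hq0 _ _ _ (by simp) H hH (mul_left_cancel₀ h4 ?_)
  have hden := period_denominator_odd w α β s t q PowerSeries.X hα hβ hw hnS
  simp only [quarticB2, apply_ite polyToSeries, map_add, map_sub, map_mul, map_pow, map_neg,
    map_natCast, map_intCast, map_ofNat, map_one, polyToSeries_X]
  rw [← hden, ← mul_assoc, hD, ← mul_assoc]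
  rw [Nat.odd_iff] at hpar
  interval_cases hk4 : k % 4
  -- For f odd, -1 has index 2 modulo 4, so the weights are rotated by k + 2 instead of k.
  · obtain ⟨rfl, rfl, rfl, rfl⟩ := ha2 (by omega)
    have hnum := period_numerator_odd_zero w α β s t q PowerSeries.X hα hβ hw hnS
    exact hnum
  · obtain ⟨rfl, rfl, rfl, rfl⟩ := ha3 (by omega)
    have hnum := period_numerator_odd_one w α β s t q PowerSeries.X hα hβ hαβ hw hnS
    exact hnum
  · obtain ⟨rfl, rfl, rfl, rfl⟩ := ha0 (by omega)
    have hnum := period_numerator_odd_two w α β s t q PowerSeries.X hα hβ hw hnS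
    exact hnum
  · obtain ⟨rfl, rfl, rfl, rfl⟩ := ha1 (by omega)
    have hnum := period_numerator_odd_three w α β s t q PowerSeries.X hα hβ hαβ hw hnS
    exact hnum

theorem quarticGenFun_eq_of_card_mod_four_eq_three {q : ℕ} (hF : Fintype.card F = q)
    (hq4 : q % 4 = 3) (c : F) :
    (c = 0 →
      quarticGenFun F c =
        expandFrac X (1 - (q : ℚ[X]) * X) +
        expandFrac ((1 - (q : ℚ[X])) * X ^ 2) (1 + (q : ℚ[X]) * X ^ 2)) ∧
    (c ≠ 0 → IsSquare c →
      quarticGenFun F c =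
        expandFrac X (1 - (q : ℚ[X]) * X) +
        expandFrac (X + X ^ 2) (1 + (q : ℚ[X]) * X ^ 2)) ∧
    (¬ IsSquare c →
      quarticGenFun F c =
        expandFrac X (1 - (q : ℚ[X]) * X) +
        expandFrac (-X + X ^ 2) (1 + (q : ℚ[X]) * X ^ 2)) := by
  classical
  have hq0 : q ≠ 0 := by omega
  obtain ⟨H, hH, hD⟩ := exists_quadratic_series (by rwa [hF]) c
  rw [hF] at hH hD
  refine ⟨fun hc => ?_, fun hc hsq => ?_, fun hsq => ?_⟩
  · refine eq_expandFrac_add_expandFrac hq0 _ _ _ (by simp) H hH ?_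
    simpa [hc] using hD
  · refine eq_expandFrac_add_expandFrac hq0 _ _ _ (by simp) H hH ?_
    simpa [hc, (quadraticChar_one_iff_isSquare hc).mpr hsq, -quadraticChar_apply] using hD
  · have hc : c ≠ 0 := by
      rintro rfl
      exact hsq IsSquare.zero
    refine eq_expandFrac_add_expandFrac hq0 _ _ _ (by simp) H hH ?_
    simpa [hc, quadraticChar_neg_one_iff_not_isSquare.mpr hsq, -quadraticChar_apply] using hD

end GeneratingFunctions

open Polynomial in
theorem theorem1p2 {F : Type*} [Field F] [Fintype F] (p m q : ℕ)
    (hp : p.Prime) (hp2 : p ≠ 2) (hq : q = p ^ m) (hF : Fintype.card F = q) :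
    (q % 4 = 1 → ∀ g : Fˣ, (∀ u : Fˣ, u ∈ Subgroup.zpowers g) →
      (∃! st : ℤ × ℤ, QuarticParams p m q g st.1 st.2) ∧
      ∀ s t : ℤ, QuarticParams p m q g s t → ∀ c : Fˣ,
        (q % 8 = 1 →
          quarticGenFun F (c : F) =
            expandFrac X (1 - (q : ℚ[X]) * X) +
            expandFrac
              (6 * (s : ℚ[X]) * X ^ 3 + ((q : ℚ[X]) - 4 * (s : ℚ[X]) ^ 2) * X ^ 4
                + quarticB1 q s t (indexBase g c))
              (1 - 6 * (q : ℚ[X]) * X ^ 2 + 8 * (q : ℚ[X]) * (s : ℚ[X]) * X ^ 3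
                + ((q : ℚ[X]) ^ 2 - 4 * (q : ℚ[X]) * (s : ℚ[X]) ^ 2) * X ^ 4)) ∧
        (q % 8 = 5 →
          quarticGenFun F (c : F) =
            expandFrac X (1 - (q : ℚ[X]) * X) +
            expandFrac
              (6 * (s : ℚ[X]) * X ^ 3 + (9 * (q : ℚ[X]) - 4 * (s : ℚ[X]) ^ 2) * X ^ 4
                + quarticB2 q s t (indexBase g c))
              (1 + 2 * (q : ℚ[X]) * X ^ 2 + 8 * (q : ℚ[X]) * (s : ℚ[X]) * X ^ 3
                + (9 * (q : ℚ[X]) ^ 2 - 4 * (q : ℚ[X]) * (s : ℚ[X]) ^ 2) * X ^ 4))) ∧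
    (q % 4 = 3 → ∀ c : F,
      (c = 0 →
        quarticGenFun F c =
          expandFrac X (1 - (q : ℚ[X]) * X) +
          expandFrac ((1 - (q : ℚ[X])) * X ^ 2) (1 + (q : ℚ[X]) * X ^ 2)) ∧
      (c ≠ 0 → IsSquare c →
        quarticGenFun F c =
          expandFrac X (1 - (q : ℚ[X]) * X) +
          expandFrac (X + X ^ 2) (1 + (q : ℚ[X]) * X ^ 2)) ∧
      (¬ IsSquare c →
        quarticGenFun F c =
          expandFrac X (1 - (q : ℚ[X]) * X) +
          expandFrac (-X + X ^ 2) (1 + (q : ℚ[X]) * X ^ 2))) := by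
  refine ⟨fun hq4 g hg => ?_, fun hq4 c => quarticGenFun_eq_of_card_mod_four_eq_three hF hq4 c⟩
  obtain ⟨f, hf⟩ : ∃ f, q = 4 * f + 1 := ⟨q / 4, by omega⟩
  have hf0 : f ≠ 0 := by
    have := Fintype.one_lt_card (α := F)
    omega
  obtain ⟨s₀, t₀, χ, hst₀, hn, hχ, hrel⟩ := exists_quarticParams hp hq hF hf0 hf hg
  have huniq : ∀ s t : ℤ, QuarticParams p m q g s t → s = s₀ ∧ t = t₀ := fun s t h =>
    quarticParams_unique hp hp2 hq hF hf0 hf hg h hst₀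
  refine ⟨⟨(s₀, t₀), hst₀, fun st h => ?_⟩, fun s t hst c => ?_⟩
  · obtain ⟨h1, h2⟩ := huniq _ _ h
    exact Prod.ext h1 h2
  obtain ⟨rfl, rfl⟩ := huniq s t hst
  have hc : (c : F) = (g : F) ^ indexBase g c := by
    -- Nonemptiness makes the infimum an attained minimum rather than the default value 0.
    have hne : {k : ℕ | g ^ k = c}.Nonempty :=
      mem_powers_iff_mem_zpowers.mpr (hg c)
    exact (congrArg Units.val (Nat.sInf_mem hne)).symm.trans (Units.val_pow_eq_pow_val _ _)
  rw [hc]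
  exact ⟨fun hq8 => quarticGenFun_eq_of_even hF hf0 hf hg hn hχ hrel
      (by rw [Nat.even_iff]; omega) _,
    fun hq8 => quarticGenFun_eq_of_odd hF hf0 hf hg hn hχ hrel (by rw [Nat.odd_iff]; omega) _⟩
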